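/- Let $\mathcal L$ be a first-order language, $\kappa$ an infinite cardinal and $\mathfrak C$ a $\kappa$-saturated, strongly $\kappa$-homogeneous $\mathcal L$-structure (monster model). Let $M\preceq\mathfrak C$ with $|M|<\kappa$, let $M\subseteq N\preceq\mathfrak C$ (any size, e.g. $N=M$ or $N=\mathfrak C$), and let $\bar n=(n_i)_{i\in I}$ be an enumeration of $N$, with a tuple of variables $\bar x=(x_i)_{i\in I}$. Let $S_{\bar n}(\mathfrak C)$ be the space of complete types over $\mathfrak C$ in the variables $\bar x$ that extend $\mathrm{tp}(\bar n/\emptyset)$, and $S^{\mathrm{inv}}_{\bar n}(\mathfrak C,M)$ the set of those that are invariant under $\mathrm{Aut}(\mathfrak C/M)$. For a finite tuple $\bar b$ of $\mathfrak C$ and $q\in S_{\bar n}(\mathfrak C)$ let $h_{\bar b}(q)=\{\theta(\bar n;\bar y):\theta(\bar x;\bar b)\in q\}$, a complete type over $N$. For $p\in S^{\mathrm{inv}}_{\bar n}(\mathfrak C,M)$ and $q\in S_{\bar n}(\mathfrak C)$, the type $p*q$ is defined by: $\theta(\bar x;\bar b)\in p*q$ if and only if $\theta(\bar x;\bar d)\in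 p$ for some (equivalently, every) $\bar d$ in $\mathfrak C$ realizing $h_{\bar b}(q)|_M$. This makes $S^{\mathrm{inv}}_{\bar n}(\mathfrak C,M)$ a semigroup. A Keisler measure is a finitely additive probability measure on the $\mathcal L(\mathfrak C)$-formulas in $\bar x$, identified with its unique regular Borel extension to the type space. An $M$-invariant Keisler measure $\mu$ is $M$-definable if for each $\mathcal L$-formula $\theta(\bar x;\bar y)$, with $\bar y$ finite, the function $F^\theta_\mu:S_{\bar y}(M)\to[0,1]$, $\mathrm{tp}(\bar d/M)\mapsto\mu(\theta(\bar x;\bar d))$, is continuous. For $M$-definable $\mu$ and a Keisler measure $\nu$ concentrated on $\mathrm{tp}(\bar n/\emptyset)$, the Keisler measure $\mu*\nu$ is given by $$(\mu*\nu)(\theta(\bar x;\bar b))=\int_{S_{\bar n}(\mathfrak C)}F^\theta_\mu\big(h_{\bar b}(q)|_M\big)\,d\nu(q);$$ for $q\in S_{\bar n}(\mathfrak C)$ put $\mu*q:=\mu*\delta_q$. The support $\mathrm{supp}(\mu)$ is the set of types all of whose formulas have positive $\mu$-measure, and $\mathrm{Stab}_r(\mu)=\{q\in S_{\bar n}(\mathfrak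 C):\mu*q=\mu\}$. A left ideal of a semigroup $S$ is a nonempty $J\subseteq S$ with $S*J\subseteq J$; $S$ is left-simple if it has no left ideal other than $S$. **Theorem.** Let $\mu$ be an $M$-definable Keisler measure concentrated on $\mathrm{tp}(\bar n/\emptyset)$ that is idempotent ($\mu*\mu=\mu$) and satisfies $\mathrm{supp}(\mu)\subseteq S^{\mathrm{inv}}_{\bar n}(\mathfrak C,M)$. Then $\mathrm{supp}(\mu)$ is a subsemigroup of $(S^{\mathrm{inv}}_{\bar n}(\mathfrak C,M),*)$, and the following are equivalent: 1. $\mathrm{supp}(\mu)\subseteq\mathrm{Stab}_r(\mu)$; 2. $\mathrm{supp}(\mu)$ is left-simple; 3. $\mathrm{supp}(\mu)$ has a unique minimal left ideal. Moreover, if $L$ is the unique minimal left ideal of $\mathrm{supp}(\mu)$, then $L=\mathrm{supp}(\mu)$. -/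

import Mathlib

set_option linter.unusedSectionVars false

open FirstOrder FirstOrder.Language MeasureTheory Topology Cardinal
open FirstOrder.Language.Theory

universe u v w x

namespace KeislerStar

noncomputable section

/-! ### Formulas with parameters, complete types, monster models -/

section Types

variable {L : FirstOrder.Language.{u, v}}

/-- The formula `θ(x; b)` over the parameters `A`, for an `L`-formula `θ(x; y)` and a tuple `b`
of elements of `A`. -/
def inst {A : Type*} {α β : Type*} (θ : L.Formula (α ⊕ β)) (b : β → A) : L[[A]].Formula α :=
  BoundedFormula.subst ((L.lhomWithConstants A).onFormula θ)
    (Sum.elim Term.var fun j => (L.con (b j)).term)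

theorem realize_inst {A : Type*} {α β : Type*} {X : Type*} [L[[A]].Structure X] [L.Structure X]
    [(L.lhomWithConstants A).IsExpansionOn X]
    (θ : L.Formula (α ⊕ β)) (b : β → A) (v : α → X) :
    (inst θ b).Realize v ↔ θ.Realize (Sum.elim v fun j => (L.con (b j) : X)) := by
  unfold inst Formula.Realize
  rw [BoundedFormula.realize_subst]
  have : (fun a => ((Sum.elim Term.var fun j => (L.con (b j)).term : α ⊕ β → L[[A]].Term α)
      a).realize v) = Sum.elim v fun j => (L.con (b j) : X) := by
    funext a; rcases a with a | a <;> simp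
  rw [this]
  exact LHom.realize_onFormula _ _

variable (L)

/-- The space `S_x(C)` of complete types over the whole structure `C`, in the variables
`(x_i)_{i ∈ I}`, with Mathlib's (Stone) topology. -/
abbrev GlobalType (C : Type w) [L.Structure C] (I : Type x) : Type _ :=
  (L.elementaryDiagram C).CompleteType I

/-- The space `S_k(A)` of complete `k`-types over a set `A` of parameters in `C`. -/
abbrev TypeOver {C : Type w} [L.Structure C] (A : Set C) (k : ℕ) : Type _ :=
  (L[[A]].completeTheory C).CompleteType (Fin k)

/-- `tp(d / A)`. -/
abbrev tpOver {C : Type w} [L.Structure C] [Nonempty C] (A : Set C) {k : ℕ} (d : Fin k → C) :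
    TypeOver L A k :=
  (L[[A]].completeTheory C).typeOf d

/-- `C` is a `κ`-monster model: it is `κ`-saturated and strongly `κ`-homogeneous. -/
structure IsMonster (C : Type w) [L.Structure C] [Nonempty C] (κ : Cardinal.{w}) : Prop where
  aleph0_le : ℵ₀ ≤ κ
  saturated : ∀ A : Set C, #A < κ → ∀ (k : ℕ) (p : TypeOver L A k), ∃ d : Fin k → C,
    tpOver L A d = p
  homogeneous : ∀ ι : Type w, #ι < κ → ∀ a a' : ι → C,
    (∀ θ : L.Formula ι, θ.Realize a ↔ θ.Realize a') → ∃ σ : C ≃[L] C, ∀ i, σ (a i) = a' i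

variable {L}

instance {T : L.Theory} {α : Type*} : MeasurableSpace (T.CompleteType α) := borel _

instance {T : L.Theory} {α : Type*} : BorelSpace (T.CompleteType α) := ⟨rfl⟩

theorem isMaximal_preimage {L₁ L₂ : FirstOrder.Language} (g : L₁ →ᴸ L₂) {T : L₂.Theory}
    (hT : T.IsMaximal) : Theory.IsMaximal (g.onSentence ⁻¹' T) := by
  obtain ⟨X⟩ := hT.1
  let := g.reduct X
  have : g.onSentence ⁻¹' T = L₁.completeTheory X := by
    ext s
    rw [Set.mem_preimage, mem_completeTheory, ← LHom.realize_onSentence X g, hT.mem_iff_models]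
    exact (hT.isComplete.realize_sentence_iff _ X).symm
  rw [this]
  exact completeTheory.isMaximal _ _

end Types

variable {L : FirstOrder.Language.{u, v}} {C : Type w} [L.Structure C] [Nonempty C] {I : Type x}

/-- The set `S_n(C)` of global types extending `tp(n / ∅)`. -/
def typesExt (n : I → C) : Set (GlobalType L C I) :=
  {p | ∀ θ : L.Formula I, θ.Realize n →
    Formula.equivSentence ((L.lhomWithConstants C).onFormula θ) ∈ p}

/-- A global type is `M`-invariant if it is fixed by the automorphisms of `C` fixing `M`
pointwise. -/
def TypeInvariant (M : Set C) (p : GlobalType L C I) : Prop :=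
  ∀ σ : C ≃[L] C, (∀ m ∈ M, σ m = m) → ∀ (k : ℕ) (θ : L.Formula (I ⊕ Fin k)) (b : Fin k → C),
    Formula.equivSentence (inst θ (σ ∘ b)) ∈ p ↔ Formula.equivSentence (inst θ b) ∈ p

/-- The set `S_n^inv(C, M)` of `M`-invariant global types extending `tp(n / ∅)`. -/
def invTypes (M : Set C) (n : I → C) : Set (GlobalType L C I) :=
  {p | p ∈ typesExt n ∧ TypeInvariant M p}

/-! ### The maps `h_b` -/

/-- Every global type is realized in an elementary extension. -/
theorem exists_realization (p : GlobalType L C I) :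
    ∃ (X : Theory.ModelType.{max u w, v, max u v w x} (L.elementaryDiagram C)) (a : I → X),
      (L.elementaryDiagram C).typeOf a = p := by
  obtain ⟨X, a, h⟩ := Theory.exists_modelType_is_realized_in (L.elementaryDiagram C) p
  exact ⟨X, a, h⟩

/-- An index `i` with `n i = a`, for an entry `a` of the tuple `n`. -/
def pick (n : I → C) (a : Set.range n) : I := a.2.choose

theorem pick_spec (n : I → C) (a : Set.range n) : n (pick n a) = a := a.2.choose_spec

/-- The translation of sentences `θ(n; y)` into sentences `θ(x; b)`: it replaces each constant
for an entry `n i` by the variable `x i`, and each variable `y j` by the constant for `b j`. -/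
def hHom (n : I → C) {k : ℕ} (b : Fin k → C) : L[[Set.range n]][[Fin k]] →ᴸ L[[C]][[I]] :=
  LHom.sumElim
    (LHom.sumElim ((L[[C]].lhomWithConstants I).comp (L.lhomWithConstants C))
      (LHom.sumInr.comp (LHom.constantsOnMap (pick n))))
    ((L[[C]].lhomWithConstants I).comp (LHom.sumInr.comp (LHom.constantsOnMap b)))

theorem hHom_mem_typeOf (n : I → C) {k : ℕ} (b : Fin k → C)
    (X : Theory.ModelType.{max u w, v, max u v w x} (L.elementaryDiagram C)) (a : I → X)
    (s : L[[Set.range n]][[Fin k]].Sentence) :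
    (hHom n b).onSentence s ∈ (L.elementaryDiagram C).typeOf a ↔
      letI := (L.lhomWithConstants C).reduct X
      letI : (constantsOn (Set.range n)).Structure X := constantsOn.structure (a ∘ pick n)
      letI : (constantsOn (Fin k)).Structure X := constantsOn.structure fun j => (L.con (b j) : X)
      X ⊨ s := by
  let _ := (L.lhomWithConstants C).reduct X
  let _ : (constantsOn (Set.range n)).Structure X := constantsOn.structure (a ∘ pick n)
  let _ : (constantsOn (Fin k)).Structure X := constantsOn.structure fun j => (L.con (b j) : X)
  let _ : (constantsOn I).Structure X := constantsOn.structure a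
  have hexp : (hHom (L := L) n b).IsExpansionOn X := by
    refine ⟨?_, ?_⟩
    · rintro m ((f | c) | d) xs
      · rfl
      · match m, c with
        | 0, c => rfl
      · match m, d with
        | 0, d =>
          have : xs = default := Subsingleton.elim _ _
          subst this
          rfl
    · rintro m ((R | R) | R) xs
      · rfl
      · exact R.elim
      · exact R.elim
  rw [CompleteType.mem_typeOf, Formula.realize_equivSentence_symm]
  exact LHom.realize_onSentence X (hHom n b) s

/-- The map `h_b : S_n(C) → S_y(N)`, where `n` enumerates `N`; it sends `q` to the type
`{θ(n; y) | θ(x; b) ∈ q}` (see `mem_hMap`). -/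
def hMap (n : I → C) {k : ℕ} (b : Fin k → C) (q : typesExt (L := L) n) :
    TypeOver L (Set.range n) k where
  toTheory := (hHom n b).onSentence ⁻¹' (q : GlobalType L C I).toTheory
  subset' := by
    obtain ⟨q, hq⟩ := q
    obtain ⟨X, a, rfl⟩ := exists_realization q
    rintro _ ⟨s, hs, rfl⟩
    refine (hHom_mem_typeOf n b X a _).2 ?_
    let _ := (L.lhomWithConstants C).reduct X
    let _ : (constantsOn (Set.range n)).Structure X := constantsOn.structure (a ∘ pick n)
    let _ : (constantsOn (Fin k)).Structure X := constantsOn.structure fun j => (L.con (b j) : X)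
    refine (LHom.realize_onSentence X _ s).2 ?_
    have h1 : (Formula.equivSentence.symm s).Realize ((↑) : Set.range n → C) :=
      (Formula.realize_equivSentence_symm C s _).2 hs
    have h2 := hq ((Formula.equivSentence.symm s).relabel (pick n)) (by
      rw [Formula.realize_relabel]
      convert h1 using 1
      funext c
      exact pick_spec n c)
    rw [CompleteType.formula_mem_typeOf, LHom.realize_onFormula, Formula.realize_relabel] at h2
    exact (Formula.realize_equivSentence_symm X s _).1 h2
  isMaximal' := isMaximal_preimage _ q.1.isMaximal

/-- `θ(n; y) ∈ h_b(q)` if and only if `θ(x; b) ∈ q`. -/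
theorem mem_hMap (n : I → C) {k : ℕ} (b : Fin k → C) (q : typesExt (L := L) n)
    (θ : L.Formula (I ⊕ Fin k)) :
    Formula.equivSentence (inst (A := Set.range n) (θ.relabel Sum.swap)
      fun i : I => ⟨n i, Set.mem_range_self i⟩) ∈ hMap n b q ↔
    Formula.equivSentence (inst θ b) ∈ (q : GlobalType L C I) := by
  obtain ⟨q, hq⟩ := q
  obtain ⟨X, a, rfl⟩ := exists_realization q
  refine (hHom_mem_typeOf n b X a _).trans ?_
  let _ := (L.lhomWithConstants C).reduct X
  let _ : (constantsOn (Set.range n)).Structure X := constantsOn.structure (a ∘ pick n)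
  let _ : (constantsOn (Fin k)).Structure X := constantsOn.structure fun j => (L.con (b j) : X)
  rw [CompleteType.formula_mem_typeOf, Formula.realize_equivSentence, realize_inst, realize_inst,
    Formula.realize_relabel]
  have key : ∀ i, a (pick n ⟨n i, Set.mem_range_self i⟩) = a i := by
    intro i
    have h2 := hq ((Term.var (pick n ⟨n i, Set.mem_range_self i⟩)).equal (Term.var i)) (by
      rw [Formula.realize_equal]
      exact pick_spec n _)
    rw [CompleteType.formula_mem_typeOf, LHom.realize_onFormula, Formula.realize_equal] at h2
    exact h2
  refine iff_of_eq (congrArg _ ?_)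
  funext z
  rcases z with i | j
  · exact key i
  · rfl

theorem onSentence_comp {L₁ L₂ L₃ : FirstOrder.Language} (g : L₂ →ᴸ L₃) (f : L₁ →ᴸ L₂)
    (s : L₁.Sentence) : g.onSentence (f.onSentence s) = (g.comp f).onSentence s :=
  (congrFun (LHom.comp_onBoundedFormula g f) s).symm

/-- The restriction `S_k(B) → S_k(A)` for `A ⊆ B`. -/
def restr {A B : Set C} (h : A ⊆ B) {k : ℕ} (p : TypeOver L B k) : TypeOver L A k where
  toTheory := ((L.lhomWithConstantsMap (Set.inclusion h)).addConstants (Fin k)).onSentence ⁻¹'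
    p.toTheory
  subset' := by
    rintro _ ⟨s, hs, rfl⟩
    refine p.subset ⟨(L.lhomWithConstantsMap (Set.inclusion h)).onSentence s, ?_, ?_⟩
    · exact (LHom.realize_onSentence C _ s).2 hs
    · rw [onSentence_comp, onSentence_comp]
      rfl
  isMaximal' := isMaximal_preimage _ p.isMaximal

/-! ### Auxiliary facts on realizations -/

open scoped Classical in
/-- `∀ x, θ(x; y)`, for a possibly infinite tuple `x` of variables. -/
def allX {J : Type*} (θ : L.Formula (I ⊕ J)) : L.Formula J :=
  Formula.iAlls θ.freeVarFinset (BoundedFormula.restrictFreeVar θ fun s =>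
    match s with
    | ⟨Sum.inl i, h⟩ => Sum.inr ⟨Sum.inl i, h⟩
    | ⟨Sum.inr j, _⟩ => Sum.inl j)

theorem realize_allX {J : Type*} {X : Type*} [L.Structure X] [Nonempty X] (θ : L.Formula (I ⊕ J))
    (b : J → X) : (allX θ).Realize b ↔ ∀ v : I → X, θ.Realize (Sum.elim v b) := by
  classical
  unfold allX
  rw [Formula.realize_iAlls]
  constructor
  · intro H v
    have := H fun s => Sum.elim v b s.1
    unfold Formula.Realize at this ⊢
    refine (BoundedFormula.realize_restrictFreeVar (v' := Sum.elim v b) ?_).1 this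
    rintro ⟨i | j, h⟩ <;> rfl
  · intro H w
    let v : I → X := fun i => if h : Sum.inl i ∈ θ.freeVarFinset then w ⟨Sum.inl i, h⟩
      else Classical.arbitrary X
    unfold Formula.Realize at H ⊢
    refine (BoundedFormula.realize_restrictFreeVar (v' := Sum.elim v b) ?_).2 (H v)
    rintro ⟨i | j, h⟩
    · simp [v, h]
    · rfl

/-- Every formula over `C` has the form `θ(x; b)`. -/
theorem exists_inst (φ : L[[C]].Formula I) : ∃ (k : ℕ) (θ : L.Formula (I ⊕ Fin k)) (b : Fin k → C),
    ∀ v : I → C, φ.Realize v ↔ (inst θ b).Realize v := by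
  classical
  let θ₀ : L.BoundedFormula (C ⊕ I) 0 := BoundedFormula.constantsVarsEquiv φ
  let e := θ₀.freeVarFinset.equivFin
  refine ⟨_, θ₀.restrictFreeVar fun s => match s with
    | ⟨Sum.inl c, h⟩ => Sum.inr (e ⟨Sum.inl c, h⟩)
    | ⟨Sum.inr i, _⟩ => Sum.inl i, fun j => Sum.elim id (fun _ => Classical.arbitrary C)
      (e.symm j).1, fun v => ?_⟩
  rw [realize_inst]
  unfold Formula.Realize
  rw [BoundedFormula.realize_restrictFreeVar (v' := Sum.elim (fun c => (L.con c : C)) v)]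
  · exact BoundedFormula.realize_constantsVarsEquiv.symm
  · rintro ⟨c | i, h⟩
    · simp
    · rfl

/-- Two formulas over `C` can be written with a common tuple of parameters. -/
theorem exists_inst₂ (φ ψ : L[[C]].Formula I) :
    ∃ (k : ℕ) (θ θ' : L.Formula (I ⊕ Fin k)) (b : Fin k → C),
      (∀ v : I → C, φ.Realize v ↔ (inst θ b).Realize v) ∧
      (∀ v : I → C, ψ.Realize v ↔ (inst θ' b).Realize v) := by
  obtain ⟨k, θ, b, h⟩ := exists_inst φ
  obtain ⟨k', θ', b', h'⟩ := exists_inst ψ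
  refine ⟨k + k', θ.relabel (Sum.map id (Fin.castAdd k')), θ'.relabel (Sum.map id (Fin.natAdd k)),
    Fin.append b b', fun v => ?_, fun v => ?_⟩
  · rw [h, realize_inst, realize_inst, Formula.realize_relabel]
    refine iff_of_eq (congrArg _ ?_)
    funext z
    rcases z with i | j <;> simp
  · rw [h', realize_inst, realize_inst, Formula.realize_relabel]
    refine iff_of_eq (congrArg _ ?_)
    funext z
    rcases z with i | j <;> simp

theorem onSentence_mem_tpOver (M : Set C) {k l : ℕ} (e : Fin l → Fin k) (d : Fin k → C)
    (s : L[[M]][[Fin l]].Sentence) :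
    (L[[M]].lhomWithConstantsMap e).onSentence s ∈ tpOver L M d ↔ s ∈ tpOver L M (d ∘ e) := by
  rw [CompleteType.mem_typeOf, CompleteType.mem_typeOf, Formula.realize_equivSentence_symm,
    Formula.realize_equivSentence_symm]
  let _ : (constantsOn (Fin k)).Structure C := constantsOn.structure d
  let _ : (constantsOn (Fin l)).Structure C := constantsOn.structure (d ∘ e)
  have : (LHom.constantsOnMap e).IsExpansionOn C := constantsOnMap_isExpansionOn rfl
  have : (L[[M]].lhomWithConstantsMap e).IsExpansionOn C := LHom.sumMap_isExpansionOn _ _ _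
  exact LHom.realize_onSentence C (L[[M]].lhomWithConstantsMap e) s

section

variable {M : Set C} {n : I → C} (hMn : M ⊆ Set.range n)

theorem tpOver_comp {k l : ℕ} (e : Fin l → Fin k) {d b : Fin k → C}
    {q : typesExt (L := L) n} (h : tpOver L M d = restr hMn (hMap n b q)) :
    tpOver L M (d ∘ e) = restr hMn (hMap n (b ∘ e) q) := by
  refine SetLike.ext fun s => ?_
  rw [← onSentence_mem_tpOver, h]
  change (hHom n b).onSentence (LHom.onSentence _ (LHom.onSentence _ s)) ∈ q.1 ↔
    (hHom n (b ∘ e)).onSentence (LHom.onSentence _ s) ∈ q.1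
  rw [onSentence_comp, onSentence_comp, onSentence_comp]
  refine iff_of_eq (congrArg (fun g => LHom.onSentence g s ∈ q.1) ?_)
  refine LHom.funext ?_ ?_
  · funext m f
    rcases f with (f | c) | j
    · rfl
    · match m, c with
      | 0, c => rfl
    · match m, j with
      | 0, j => rfl
  · funext m R
    rcases R with (R | R) | R
    · rfl
    · exact R.elim
    · exact R.elim

theorem realize_iff_of_tpOver {k : ℕ} {d b : Fin k → C} {q : typesExt (L := L) n}
    (h : tpOver L M d = restr hMn (hMap n b q)) (ρ : L.Formula (Fin k)) :
    ρ.Realize d ↔ ρ.Realize b := by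
  obtain ⟨q, hq⟩ := q
  obtain ⟨X, a, rfl⟩ := exists_realization q
  let s := Formula.equivSentence ((L.lhomWithConstants M).onFormula ρ)
  have h1 : s ∈ tpOver L M d ↔ ρ.Realize d := by
    rw [CompleteType.formula_mem_typeOf, LHom.realize_onFormula]
  rw [← h1, h]
  refine (hHom_mem_typeOf n b X a _).trans ?_
  let _ := (L.lhomWithConstants C).reduct X
  let _ : (constantsOn (Set.range n)).Structure X := constantsOn.structure (a ∘ pick n)
  let _ : (constantsOn (Fin k)).Structure X := constantsOn.structure fun j => (L.con (b j) : X)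
  let _ : (constantsOn M).Structure X := constantsOn.structure (a ∘ pick n ∘ Set.inclusion hMn)
  have : (LHom.constantsOnMap (Set.inclusion hMn)).IsExpansionOn X :=
    constantsOnMap_isExpansionOn rfl
  have : (L.lhomWithConstantsMap (Set.inclusion hMn)).IsExpansionOn X :=
    LHom.sumMap_isExpansionOn _ _ _
  have : ((L.lhomWithConstantsMap (Set.inclusion hMn)).addConstants (Fin k)).IsExpansionOn X :=
    LHom.sumMap_isExpansionOn _ _ _
  refine (LHom.realize_onSentence X _ s).trans ?_
  rw [Formula.realize_equivSentence, LHom.realize_onFormula]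
  exact (ElementaryEmbedding.ofModelsElementaryDiagram L C X).map_formula ρ b

theorem exists_aut_of_tpOver {κ : Cardinal.{w}} (hC : IsMonster L C κ) (hM : #M < κ) {k : ℕ}
    {d d' : Fin k → C} (h : tpOver L M d = tpOver L M d') :
    ∃ σ : C ≃[L] C, (∀ m ∈ M, σ m = m) ∧ σ ∘ d = d' := by
  obtain ⟨σ, hσ⟩ := hC.homogeneous (M ⊕ ULift.{w} (Fin k)) (by
      rw [mk_sum, lift_id, lift_id]
      refine add_lt_of_lt hC.aleph0_le hM (lt_of_lt_of_le ?_ hC.aleph0_le)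
      exact lt_aleph0_of_finite _)
    (Sum.elim (↑) fun j => d j.down) (Sum.elim (↑) fun j => d' j.down) (fun θ => by
      let ψ : L[[M]].Formula (Fin k) := inst (θ.relabel fun z : M ⊕ ULift.{w} (Fin k) =>
        (Sum.elim Sum.inr (fun j => Sum.inl j.down) z : Fin k ⊕ M)) id
      have key : ∀ e : Fin k → C, ψ.Realize e ↔ θ.Realize
          (Sum.elim (↑) fun j => e j.down : M ⊕ ULift.{w} (Fin k) → C) := by
        intro e
        rw [realize_inst, Formula.realize_relabel]
        refine iff_of_eq (congrArg _ ?_)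
        funext z
        rcases z with m | j <;> rfl
      rw [← key, ← key, ← CompleteType.formula_mem_typeOf (T := L[[M]].completeTheory C),
        ← CompleteType.formula_mem_typeOf (T := L[[M]].completeTheory C)]
      exact iff_of_eq (congrArg (fun p => Formula.equivSentence ψ ∈ p) h))
  exact ⟨σ, fun m hm => hσ (Sum.inl ⟨m, hm⟩), funext fun j => hσ (Sum.inr ⟨j⟩)⟩

end

/-! ### Keisler measures -/

variable (L C I) in
/-- A Keisler measure in the variables `(x_i)_{i ∈ I}` over `C`: a finitely additive probability
measure on the formulas over `C`. -/
structure KeislerMeasure where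
  toFun : L[[C]].Formula I → ℝ
  nonneg' : ∀ φ, 0 ≤ toFun φ
  total' : ∀ φ, (∀ v : I → C, φ.Realize v) → toFun φ = 1
  additive' : ∀ φ ψ, (∀ v : I → C, ¬(φ.Realize v ∧ ψ.Realize v)) →
    toFun (φ ⊔ ψ) = toFun φ + toFun ψ

namespace KeislerMeasure

instance : FunLike (KeislerMeasure L C I) (L[[C]].Formula I) ℝ where
  coe := toFun
  coe_injective μ ν h := by cases μ; cases ν; congr

variable (μ : KeislerMeasure L C I)

theorem nonneg (φ : L[[C]].Formula I) : 0 ≤ μ φ := μ.nonneg' φ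

theorem total {φ : L[[C]].Formula I} (h : ∀ v : I → C, φ.Realize v) : μ φ = 1 := μ.total' φ h

theorem additive {φ ψ : L[[C]].Formula I} (h : ∀ v : I → C, ¬(φ.Realize v ∧ ψ.Realize v)) :
    μ (φ ⊔ ψ) = μ φ + μ ψ := μ.additive' φ ψ h

theorem not_eq (φ : L[[C]].Formula I) : μ φ.not = 1 - μ φ := by
  have h1 := μ.additive (φ := φ) (ψ := φ.not) fun v h => h.2 h.1
  have h2 := μ.total (φ := φ ⊔ φ.not) fun v => by
    rw [Formula.realize_sup, Formula.realize_not]; exact em _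
  linarith

theorem le_one (φ : L[[C]].Formula I) : μ φ ≤ 1 := by
  have := μ.nonneg φ.not
  rw [not_eq] at this
  linarith

theorem congr {φ ψ : L[[C]].Formula I} (h : ∀ v : I → C, φ.Realize v ↔ ψ.Realize v) :
    μ φ = μ ψ := by
  have h1 := μ.additive (φ := φ) (ψ := ψ.not) fun v h' => h'.2 ((h v).1 h'.1)
  have h2 := μ.total (φ := φ ⊔ ψ.not) fun v => by
    rw [Formula.realize_sup, Formula.realize_not, h]; exact em _
  rw [not_eq] at h1
  linarith

theorem eq_add (φ ψ : L[[C]].Formula I) : μ φ = μ (φ ⊓ ψ) + μ (φ ⊓ ψ.not) := by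
  rw [← μ.additive]
  · refine μ.congr fun v => ?_
    simp only [Formula.realize_sup, Formula.realize_inf, Formula.realize_not]
    tauto
  · intro v
    simp only [Formula.realize_inf, Formula.realize_not]
    tauto

theorem mono {φ ψ : L[[C]].Formula I} (h : ∀ v : I → C, φ.Realize v → ψ.Realize v) :
    μ φ ≤ μ ψ := by
  rw [μ.eq_add ψ φ, μ.congr (φ := φ) (ψ := ψ ⊓ φ)]
  · linarith [μ.nonneg (ψ ⊓ φ.not)]
  · intro v
    rw [Formula.realize_inf]
    exact ⟨fun h' => ⟨h v h', h'⟩, fun h' => h'.2⟩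

theorem sup_le (φ ψ : L[[C]].Formula I) : μ (φ ⊔ ψ) ≤ μ φ + μ ψ := by
  rw [μ.eq_add ψ φ, μ.congr (φ := φ ⊔ ψ) (ψ := φ ⊔ (ψ ⊓ φ.not)), μ.additive]
  · linarith [μ.nonneg (ψ ⊓ φ)]
  · intro v
    simp only [Formula.realize_inf, Formula.realize_not]
    tauto
  · intro v
    simp only [Formula.realize_sup, Formula.realize_inf, Formula.realize_not]
    tauto

end KeislerMeasure

/-! ### The regular Borel measure of a Keisler measure -/

/-- The clopen set `[φ]` of global types containing `φ`. -/
def basicSet (φ : L[[C]].Formula I) : Set (GlobalType L C I) :=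
  {p | Formula.equivSentence φ ∈ p}

theorem isClopen_basicSet (φ : L[[C]].Formula I) : IsClopen (basicSet φ) :=
  CompleteType.isClopen_typesWith (Formula.equivSentence φ)

theorem basicSet_sup (φ ψ : L[[C]].Formula I) : basicSet (φ ⊔ ψ) = basicSet φ ∪ basicSet ψ := by
  ext p
  obtain ⟨X, a, rfl⟩ := exists_realization p
  simp only [basicSet, Set.mem_union, Set.mem_ofPred_eq, CompleteType.formula_mem_typeOf,
    Formula.realize_sup]

theorem basicSet_inf (φ ψ : L[[C]].Formula I) : basicSet (φ ⊓ ψ) = basicSet φ ∩ basicSet ψ := by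
  ext p
  obtain ⟨X, a, rfl⟩ := exists_realization p
  simp only [basicSet, Set.mem_inter_iff, Set.mem_ofPred_eq, CompleteType.formula_mem_typeOf,
    Formula.realize_inf]

theorem basicSet_not (φ : L[[C]].Formula I) : basicSet φ.not = (basicSet φ)ᶜ := by
  ext p
  obtain ⟨X, a, rfl⟩ := exists_realization p
  simp only [basicSet, Set.mem_compl_iff, Set.mem_ofPred_eq, CompleteType.formula_mem_typeOf,
    Formula.realize_not]

theorem typeOf_mem_basicSet (φ : L[[C]].Formula I) (v : I → C) :
    (L.elementaryDiagram C).typeOf v ∈ basicSet φ ↔ φ.Realize v :=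
  CompleteType.formula_mem_typeOf (T := L.elementaryDiagram C)

theorem basicSet_bot : basicSet (⊥ : L[[C]].Formula I) = ∅ := by
  ext p
  obtain ⟨X, a, rfl⟩ := exists_realization p
  simp only [basicSet, Set.mem_empty_iff_false, Set.mem_ofPred_eq, CompleteType.formula_mem_typeOf,
    Formula.realize_bot]

theorem basicSet_top : basicSet (⊤ : L[[C]].Formula I) = Set.univ := by
  ext p
  obtain ⟨X, a, rfl⟩ := exists_realization p
  simp only [basicSet, Set.mem_univ, Set.mem_ofPred_eq, CompleteType.formula_mem_typeOf,
    Formula.realize_top]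

theorem realize_of_basicSet_subset {φ ψ : L[[C]].Formula I} (h : basicSet φ ⊆ basicSet ψ)
    (v : I → C) (hv : φ.Realize v) : ψ.Realize v := by
  exact (typeOf_mem_basicSet ψ v).1 (h ((typeOf_mem_basicSet φ v).2 hv))

theorem basicSet_subset_of_realize {φ ψ : L[[C]].Formula I}
    (h : ∀ v : I → C, φ.Realize v → ψ.Realize v) : basicSet φ ⊆ basicSet ψ := by
  intro p hp
  obtain ⟨X, a, rfl⟩ := exists_realization p
  have hp' : φ.Realize a := (CompleteType.formula_mem_typeOf (T := L.elementaryDiagram C)).1 hp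
  refine (CompleteType.formula_mem_typeOf (T := L.elementaryDiagram C)).2 ?_
  let ρ : L[[C]].Sentence := allX ((φ.imp ψ).relabel Sum.inl : L[[C]].Formula (I ⊕ Empty))
  have h1 : C ⊨ ρ := (realize_allX _ _).2 fun v => by
    rw [Formula.realize_relabel, Formula.realize_imp]
    exact h v
  have h2 : X ⊨ ρ := (realize_iff_of_model_completeTheory C X ρ).2 h1
  have h3 := (realize_allX _ _).1 h2 a
  rw [Formula.realize_relabel, Formula.realize_imp] at h3
  exact h3 hp'

theorem exists_basicSet_subset {p : GlobalType L C I} {U : Set (GlobalType L C I)} (hU : IsOpen U)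
    (hp : p ∈ U) : ∃ φ : L[[C]].Formula I, p ∈ basicSet φ ∧ basicSet φ ⊆ U := by
  obtain ⟨_, ⟨s, rfl⟩, h1, h2⟩ :=
    CompleteType.isTopologicalBasis_range_typesWith.exists_subset_of_mem_open hp hU
  have : basicSet (Formula.equivSentence.symm s) =
      (L.elementaryDiagram C).typesWith (α := I) s := by
    ext p
    simp [basicSet]
  exact ⟨Formula.equivSentence.symm s, this ▸ h1, this ▸ h2⟩

theorem exists_basicSet_between {K U : Set (GlobalType L C I)} (hK : IsCompact K) (hU : IsOpen U)
    (hKU : K ⊆ U) : ∃ φ : L[[C]].Formula I, K ⊆ basicSet φ ∧ basicSet φ ⊆ U := by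
  have := hK.induction_on (p := fun s => ∃ φ : L[[C]].Formula I, s ⊆ basicSet φ ∧ basicSet φ ⊆ U)
    ⟨⊥, Set.empty_subset _, by
      rw [basicSet_bot]; exact Set.empty_subset _⟩
    (fun s t hst ⟨φ, h1, h2⟩ => ⟨φ, hst.trans h1, h2⟩)
    (fun s t ⟨φ, h1, h2⟩ ⟨ψ, h3, h4⟩ => ⟨φ ⊔ ψ, by
      rw [basicSet_sup]; exact Set.union_subset_union h1 h3, by
      rw [basicSet_sup]; exact Set.union_subset h2 h4⟩)
    (fun p hp => by
      obtain ⟨φ, h1, h2⟩ := exists_basicSet_subset hU (hKU hp)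
      exact ⟨basicSet φ, mem_nhdsWithin_of_mem_nhds ((isClopen_basicSet φ).2.mem_nhds h1),
        φ, subset_rfl, h2⟩)
  exact this

namespace KeislerMeasure

variable (μ : KeislerMeasure L C I)

/-- The value of the outer extension of `μ` on a compact set. -/
def outer (K : Set (GlobalType L C I)) : NNReal :=
  ⨅ φ : {φ : L[[C]].Formula I // K ⊆ basicSet φ}, (μ φ.1).toNNReal

theorem outer_le {K : Set (GlobalType L C I)} {φ : L[[C]].Formula I} (h : K ⊆ basicSet φ) :
    μ.outer K ≤ (μ φ).toNNReal :=
  ciInf_le' (fun φ : {φ : L[[C]].Formula I // K ⊆ basicSet φ} => (μ φ.1).toNNReal) ⟨φ, h⟩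

instance (K : Set (GlobalType L C I)) : Nonempty {φ : L[[C]].Formula I // K ⊆ basicSet φ} :=
  ⟨⟨⊤, by
    rw [basicSet_top]; exact Set.subset_univ _⟩⟩

theorem le_outer {K : Set (GlobalType L C I)} {r : NNReal}
    (h : ∀ φ : L[[C]].Formula I, K ⊆ basicSet φ → r ≤ (μ φ).toNNReal) : r ≤ μ.outer K :=
  le_ciInf fun φ => h φ.1 φ.2

theorem exists_outer_lt {K : Set (GlobalType L C I)} {r : NNReal} (h : μ.outer K < r) :
    ∃ φ : L[[C]].Formula I, K ⊆ basicSet φ ∧ (μ φ).toNNReal < r := by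
  obtain ⟨φ, hφ⟩ := exists_lt_of_ciInf_lt h
  exact ⟨φ.1, φ.2, hφ⟩

theorem outer_basicSet (φ : L[[C]].Formula I) : μ.outer (basicSet φ) = (μ φ).toNNReal :=
  le_antisymm (μ.outer_le subset_rfl) <| μ.le_outer fun _ h =>
    Real.toNNReal_le_toNNReal (μ.mono (realize_of_basicSet_subset h))

theorem outer_union_le (K₁ K₂ : Set (GlobalType L C I)) :
    μ.outer (K₁ ∪ K₂) ≤ μ.outer K₁ + μ.outer K₂ := by
  refine le_of_forall_pos_le_add fun ε hε => le_of_lt ?_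
  obtain ⟨φ, h1, h2⟩ := μ.exists_outer_lt (lt_add_of_pos_right (μ.outer K₁) (half_pos hε))
  obtain ⟨ψ, h3, h4⟩ := μ.exists_outer_lt (lt_add_of_pos_right (μ.outer K₂) (half_pos hε))
  calc μ.outer (K₁ ∪ K₂) ≤ (μ (φ ⊔ ψ)).toNNReal := μ.outer_le (by
        rw [basicSet_sup]; exact Set.union_subset_union h1 h3)
    _ ≤ (μ φ + μ ψ).toNNReal := Real.toNNReal_le_toNNReal (μ.sup_le φ ψ)
    _ = (μ φ).toNNReal + (μ ψ).toNNReal := Real.toNNReal_add (μ.nonneg _) (μ.nonneg _)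
    _ < (μ.outer K₁ + ε / 2) + (μ.outer K₂ + ε / 2) := add_lt_add h2 h4
    _ = μ.outer K₁ + μ.outer K₂ + ε := by
        rw [add_add_add_comm, add_halves]

/-- The content on compact sets of types induced by `μ`. -/
def content : Content (GlobalType L C I) where
  toFun K := μ.outer K
  mono' K₁ K₂ h := μ.le_outer fun φ hφ => μ.outer_le (h.trans hφ)
  sup_disjoint' K₁ K₂ h _ h₂ := by
    obtain ⟨χ, h3, h4⟩ := exists_basicSet_between K₁.isCompact h₂.isOpen_compl
      h.subset_compl_right
    refine le_antisymm ?_ (μ.le_outer fun φ hφ => ?_)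
    · exact μ.outer_union_le _ _
    · rw [TopologicalSpace.Compacts.coe_sup, Set.union_subset_iff] at hφ
      rw [μ.eq_add φ χ, Real.toNNReal_add (μ.nonneg _) (μ.nonneg _)]
      refine add_le_add (μ.outer_le ?_) (μ.outer_le ?_)
      · rw [basicSet_inf]
        exact Set.subset_inter hφ.1 h3
      · rw [basicSet_inf, basicSet_not]
        exact Set.subset_inter hφ.2 (Set.subset_compl_comm.1 h4)
  sup_le' K₁ K₂ := μ.outer_union_le _ _

theorem content_apply (K : TopologicalSpace.Compacts (GlobalType L C I)) :
    μ.content K = (μ.outer K : ENNReal) := rfl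

theorem contentRegular : μ.content.ContentRegular := by
  intro K
  refine le_antisymm (le_iInf₂ fun K' h => μ.content.mono _ _ (h.trans interior_subset)) ?_
  refine ENNReal.le_of_forall_pos_le_add fun ε hε _ => ?_
  obtain ⟨φ, h1, h2⟩ := μ.exists_outer_lt (lt_add_of_pos_right (μ.outer K) hε)
  refine (iInf₂_le (⟨basicSet φ, (isClopen_basicSet φ).1.isCompact⟩ :
    TopologicalSpace.Compacts (GlobalType L C I)) ?_).trans ?_
  · change (K : Set (GlobalType L C I)) ⊆ interior (basicSet φ)
    rw [(isClopen_basicSet φ).2.interior_eq]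
    exact h1
  · rw [content_apply, content_apply, TopologicalSpace.Compacts.coe_mk, outer_basicSet]
    exact_mod_cast h2.le

/-- The regular Borel probability measure on the space of global types extending `μ`. -/
def borel : Measure (GlobalType L C I) := μ.content.measure

theorem borel_basicSet (φ : L[[C]].Formula I) : μ.borel (basicSet φ) = ENNReal.ofReal (μ φ) := by
  have := μ.content.measure_eq_content_of_regular μ.contentRegular
    ⟨basicSet φ, (isClopen_basicSet φ).1.isCompact⟩
  rw [content_apply, TopologicalSpace.Compacts.coe_mk, outer_basicSet] at this
  exact this

instance : μ.borel.Regular := inferInstanceAs μ.content.measure.Regular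

instance : IsProbabilityMeasure μ.borel := ⟨by
  rw [← basicSet_top, borel_basicSet, μ.total fun v => Formula.realize_top.2 trivial,
    ENNReal.ofReal_one]⟩

end KeislerMeasure

/-! ### Keisler measures concentrated on `tp(n / ∅)`, supports, definability -/

/-- `μ` belongs to `𝔐_n(C)`: it is concentrated on `tp(n / ∅)`. -/
def ConcentratedOn (n : I → C) (μ : KeislerMeasure L C I) : Prop :=
  ∀ θ : L.Formula I, θ.Realize n → μ ((L.lhomWithConstants C).onFormula θ) = 1

/-- The support of a Keisler measure. -/
def supp (μ : KeislerMeasure L C I) : Set (GlobalType L C I) :=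
  {p | ∀ φ : L[[C]].Formula I, Formula.equivSentence φ ∈ p → 0 < μ φ}

/-- A Keisler measure is `M`-invariant if it is fixed by the automorphisms of `C` fixing `M`
pointwise. -/
def MeasureInvariant (M : Set C) (μ : KeislerMeasure L C I) : Prop :=
  ∀ σ : C ≃[L] C, (∀ m ∈ M, σ m = m) → ∀ (k : ℕ) (θ : L.Formula (I ⊕ Fin k)) (b : Fin k → C),
    μ (inst θ (σ ∘ b)) = μ (inst θ b)

open scoped Classical in
/-- The fiber function `F_μ^θ : S_y(M) → ℝ`, which sends `tp(d / M)` to `μ(θ(x; d))`. It is used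
for `M`-invariant `μ`, where the value does not depend on `d`, and for saturated `C`, where every
type in `S_y(M)` is realized. -/
def fiber (M : Set C) (μ : KeislerMeasure L C I) {k : ℕ} (θ : L.Formula (I ⊕ Fin k))
    (r : TypeOver L M k) : ℝ :=
  if h : ∃ d : Fin k → C, tpOver L M d = r then μ (inst θ h.choose) else 0

/-- `μ` is `M`-definable: it is `M`-invariant and its fiber functions over `M` are continuous. -/
def DefinableOver (M : Set C) (μ : KeislerMeasure L C I) : Prop :=
  MeasureInvariant M μ ∧
    ∀ (k : ℕ) (θ : L.Formula (I ⊕ Fin k)), Continuous (fiber M μ θ : TypeOver L M k → ℝ)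

/-- The Dirac measure of a global type. -/
def dirac (p : GlobalType L C I) : KeislerMeasure L C I where
  toFun φ := (basicSet φ).indicator (fun _ => 1) p
  nonneg' φ := Set.indicator_nonneg (fun _ _ => zero_le_one) p
  total' φ h := by
    have : basicSet φ = Set.univ := by
      refine Set.eq_univ_of_univ_subset ?_
      rw [← basicSet_top, ← Set.compl_subset_compl, ← basicSet_not, ← basicSet_not]
      exact basicSet_subset_of_realize fun v hv => (hv (h v)).elim
    rw [this, Set.indicator_univ]
  additive' φ ψ h := by
    rw [basicSet_sup]
    refine congrFun (Set.indicator_union_of_disjoint ?_ _) p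
    rw [Set.disjoint_iff_inter_eq_empty, ← basicSet_inf, ← Set.subset_empty_iff, ← basicSet_bot]
    exact basicSet_subset_of_realize fun v hv => (h v (Formula.realize_inf.1 hv)).elim

theorem dirac_eq_one_iff (p : GlobalType L C I) (φ : L[[C]].Formula I) :
    dirac p φ = 1 ↔ Formula.equivSentence φ ∈ p := by
  change (basicSet φ).indicator (fun _ => (1 : ℝ)) p = 1 ↔ p ∈ basicSet φ
  by_cases h : p ∈ basicSet φ <;> simp [h]

theorem dirac_eq_zero_or_one (p : GlobalType L C I) (φ : L[[C]].Formula I) :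
    dirac p φ = 0 ∨ dirac p φ = 1 := by
  change (basicSet φ).indicator (fun _ => (1 : ℝ)) p = 0 ∨
    (basicSet φ).indicator (fun _ => (1 : ℝ)) p = 1
  by_cases h : p ∈ basicSet φ <;> simp [h]

theorem concentratedOn_dirac {n : I → C} {q : GlobalType L C I} (hq : q ∈ typesExt n) :
    ConcentratedOn n (dirac q) :=
  fun θ hθ => (dirac_eq_one_iff q _).2 (hq θ hθ)

theorem measureInvariant_dirac {M : Set C} {p : GlobalType L C I} (hp : TypeInvariant M p) :
    MeasureInvariant M (dirac p) := by
  intro σ hσ k θ b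
  have := hp σ hσ k θ b
  rw [← dirac_eq_one_iff, ← dirac_eq_one_iff] at this
  rcases dirac_eq_zero_or_one p (inst θ (σ ∘ b)) with h | h <;>
  rcases dirac_eq_zero_or_one p (inst θ b) with h' | h' <;> simp_all

/-! ### The star product -/

section Star

variable {κ : Cardinal.{w}} {M : Set C} {n : I → C}

/-- The value `(μ ∗ q)(φ)` of the star product of an `M`-invariant measure and a type at a formula
`φ` over `C`: if `φ` is `θ(x; b)`, it is `(F_μ^θ ∘ res_M ∘ h_b)(q)` (see `starVal_inst`; the value
does not depend on the choice of `θ` and `b`). -/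
def starVal (hMn : M ⊆ Set.range n) (μ : KeislerMeasure L C I) (q : typesExt (L := L) n)
    (φ : L[[C]].Formula I) : ℝ :=
  fiber M μ (exists_inst φ).choose_spec.choose
    (restr hMn (hMap n (exists_inst φ).choose_spec.choose_spec.choose q))

theorem fiber_tpOver (hC : IsMonster L C κ) (hM : #M < κ) {μ : KeislerMeasure L C I}
    (hμ : MeasureInvariant M μ) {k : ℕ} (θ : L.Formula (I ⊕ Fin k)) (d : Fin k → C) :
    fiber M μ θ (tpOver L M d) = μ (inst θ d) := by
  have h : ∃ d' : Fin k → C, tpOver L M d' = tpOver L M d := ⟨d, rfl⟩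
  unfold fiber
  rw [dif_pos h]
  obtain ⟨σ, hσ, hσd⟩ := exists_aut_of_tpOver hC hM h.choose_spec.symm
  rw [← hσd]
  exact hμ σ hσ k θ d

theorem starVal_eq (hC : IsMonster L C κ) (hM : #M < κ) (hMn : M ⊆ Set.range n)
    {μ : KeislerMeasure L C I} (hμ : MeasureInvariant M μ) (q : typesExt (L := L) n)
    {φ : L[[C]].Formula I} {k : ℕ} {θ : L.Formula (I ⊕ Fin k)} {b d : Fin k → C}
    (hφ : ∀ v : I → C, φ.Realize v ↔ (inst θ b).Realize v)
    (hd : tpOver L M d = restr hMn (hMap n b q)) :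
    starVal hMn μ q φ = μ (inst θ d) := by
  let k' := (exists_inst φ).choose
  let θ' : L.Formula (I ⊕ Fin k') := (exists_inst φ).choose_spec.choose
  let b' : Fin k' → C := (exists_inst φ).choose_spec.choose_spec.choose
  have hφ' : ∀ v : I → C, φ.Realize v ↔ (inst θ' b').Realize v :=
    (exists_inst φ).choose_spec.choose_spec.choose_spec
  change fiber M μ θ' (restr hMn (hMap n b' q)) = _
  obtain ⟨e, he⟩ := hC.saturated M hM (k + k') (restr hMn (hMap n (Fin.append b b') q))
  have h1 := tpOver_comp hMn (Fin.castAdd k') he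
  have h2 := tpOver_comp hMn (Fin.natAdd k) he
  have hb1 : Fin.append b b' ∘ Fin.castAdd k' = b := by funext j; simp
  have hb2 : Fin.append b b' ∘ Fin.natAdd k = b' := by funext j; simp
  rw [hb1, ← hd] at h1
  rw [hb2] at h2
  rw [← h2, fiber_tpOver hC hM hμ, ← fiber_tpOver hC hM hμ, ← fiber_tpOver hC hM hμ (d := d), ← h1,
    fiber_tpOver hC hM hμ, fiber_tpOver hC hM hμ]
  refine μ.congr ?_
  let ρ : L.Formula (Fin (k + k')) := allX
    ((θ.relabel (Sum.map id (Fin.castAdd k'))).iff (θ'.relabel (Sum.map id (Fin.natAdd k))))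
  have key : ∀ e : Fin (k + k') → C, ρ.Realize e ↔ ∀ v : I → C,
      ((inst θ (e ∘ Fin.castAdd k')).Realize v ↔ (inst θ' (e ∘ Fin.natAdd k)).Realize v) := by
    intro e
    rw [realize_allX]
    refine forall_congr' fun v => ?_
    rw [Formula.realize_iff, realize_inst, realize_inst, Formula.realize_relabel,
      Formula.realize_relabel, Sum.elim_comp_map, Sum.elim_comp_map]
    rfl
  intro v
  refine ((key e).1 ((realize_iff_of_tpOver hMn he ρ).2 ((key _).2 fun v => ?_)) v).symm
  rw [hb1, hb2, ← hφ, ← hφ']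

/-- `(μ ∗ q)(θ(x; b)) = (F_μ^θ ∘ res_M ∘ h_b)(q)`. -/
theorem starVal_inst (hC : IsMonster L C κ) (hM : #M < κ) (hMn : M ⊆ Set.range n)
    {μ : KeislerMeasure L C I} (hμ : MeasureInvariant M μ) (q : typesExt (L := L) n)
    {φ : L[[C]].Formula I} {k : ℕ} {θ : L.Formula (I ⊕ Fin k)} {b : Fin k → C}
    (hφ : ∀ v : I → C, φ.Realize v ↔ (inst θ b).Realize v) :
    starVal hMn μ q φ = fiber M μ θ (restr hMn (hMap n b q)) := by
  obtain ⟨d, hd⟩ := hC.saturated M hM k (restr hMn (hMap n b q))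
  rw [starVal_eq hC hM hMn hμ q hφ hd, ← hd, fiber_tpOver hC hM hμ]

/-- The star product `μ ∗ q` of an `M`-invariant Keisler measure and a type in `S_n(C)`. -/
def starAt (hC : IsMonster L C κ) (hM : #M < κ) (hMn : M ⊆ Set.range n)
    (μ : KeislerMeasure L C I) (hμ : MeasureInvariant M μ) (q : typesExt (L := L) n) :
    KeislerMeasure L C I where
  toFun := starVal hMn μ q
  nonneg' φ := by
    obtain ⟨k, θ, b, h⟩ := exists_inst φ
    obtain ⟨d, hd⟩ := hC.saturated M hM k (restr hMn (hMap n b q))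
    rw [starVal_eq hC hM hMn hμ q h hd]
    exact μ.nonneg _
  total' φ hφ := by
    obtain ⟨k, θ, b, h⟩ := exists_inst φ
    obtain ⟨d, hd⟩ := hC.saturated M hM k (restr hMn (hMap n b q))
    rw [starVal_eq hC hM hMn hμ q h hd]
    refine μ.total fun v => ?_
    have := (realize_iff_of_tpOver hMn hd (allX θ)).2 ((realize_allX θ b).2 fun v => by
      have := (h v).1 (hφ v)
      rw [realize_inst] at this
      exact this)
    rw [realize_inst]
    exact (realize_allX θ d).1 this v
  additive' φ ψ hφψ := by
    obtain ⟨k, θ, θ', b, h, h'⟩ := exists_inst₂ φ ψ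
    obtain ⟨d, hd⟩ := hC.saturated M hM k (restr hMn (hMap n b q))
    have h'' : ∀ v : I → C, (φ ⊔ ψ).Realize v ↔ (inst (θ ⊔ θ') b).Realize v := by
      intro v
      rw [Formula.realize_sup, h, h', realize_inst, realize_inst, realize_inst,
        Formula.realize_sup]
    rw [starVal_eq hC hM hMn hμ q h hd, starVal_eq hC hM hMn hμ q h' hd,
      starVal_eq hC hM hMn hμ q h'' hd, ← μ.additive]
    · refine μ.congr fun v => ?_
      rw [Formula.realize_sup, realize_inst, realize_inst, realize_inst, Formula.realize_sup]
    · have := (realize_iff_of_tpOver hMn hd (allX (θ ⊓ θ').not)).2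
        ((realize_allX _ b).2 fun v => by
          rw [Formula.realize_not, Formula.realize_inf]
          have := hφψ v
          rw [h, h', realize_inst, realize_inst] at this
          exact this)
      intro v
      have := (realize_allX _ d).1 this v
      rw [Formula.realize_not, Formula.realize_inf] at this
      rw [realize_inst, realize_inst]
      exact this

theorem continuous_restr {A B : Set C} (h : A ⊆ B) {k : ℕ} :
    Continuous (restr h : TypeOver L B k → TypeOver L A k) := by
  refine continuous_generateFrom_iff.2 ?_
  rintro _ ⟨s, rfl⟩
  exact CompleteType.isOpen_typesWith
    (((L.lhomWithConstantsMap (Set.inclusion h)).addConstants (Fin k)).onSentence s)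

theorem continuous_hMap (n : I → C) {k : ℕ} (b : Fin k → C) :
    Continuous (hMap n b : typesExt (L := L) n → TypeOver L (Set.range n) k) := by
  refine continuous_generateFrom_iff.2 ?_
  rintro _ ⟨s, rfl⟩
  exact (CompleteType.isOpen_typesWith ((hHom n b).onSentence s)).preimage continuous_subtype_val

theorem continuous_starVal (hC : IsMonster L C κ) (hM : #M < κ) (hMn : M ⊆ Set.range n)
    {μ : KeislerMeasure L C I} (hμ : DefinableOver M μ) (φ : L[[C]].Formula I) :
    Continuous fun q : typesExt (L := L) n => starVal hMn μ q φ := by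
  obtain ⟨k, θ, b, h⟩ := exists_inst φ
  have : (fun q : typesExt (L := L) n => starVal hMn μ q φ) =
      fun q => fiber M μ θ (restr hMn (hMap n b q)) :=
    funext fun q => starVal_inst hC hM hMn hμ.1 q h
  rw [this]
  exact (hμ.2 k θ).comp ((continuous_restr hMn).comp (continuous_hMap n b))

theorem isClosed_typesExt (n : I → C) : IsClosed (typesExt (L := L) n) := by
  have : typesExt (L := L) n = ⋂ θ : {θ : L.Formula I // θ.Realize n},
      basicSet ((L.lhomWithConstants C).onFormula θ.1) := by
    ext p
    simp [typesExt, basicSet]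
  rw [this]
  exact isClosed_iInter fun θ => (isClopen_basicSet _).1

theorem borel_typesExt {ν : KeislerMeasure L C I} (hν : ConcentratedOn n ν) :
    ν.borel (typesExt n) = 1 := by
  rw [← prob_compl_eq_zero_iff (isClosed_typesExt n).measurableSet,
    (isClosed_typesExt n).isOpen_compl.measure_eq_iSup_isCompact]
  simp only [ENNReal.iSup_eq_zero]
  intro K hK hKc
  refine hKc.measure_zero_of_nhdsWithin fun p hp => ?_
  have : ¬ p ∈ typesExt n := hK hp
  simp only [typesExt, Set.mem_ofPred_eq, not_forall] at this
  obtain ⟨θ, hθ, h⟩ := this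
  refine ⟨basicSet ((L.lhomWithConstants C).onFormula θ).not,
    mem_nhdsWithin_of_mem_nhds ((isClopen_basicSet _).2.mem_nhds ?_), ?_⟩
  · rw [basicSet_not]
    exact h
  · rw [ν.borel_basicSet, ν.not_eq, hν θ hθ, sub_self, ENNReal.ofReal_zero]

/-- A Keisler measure concentrated on `tp(n / ∅)`, as a Borel measure on `S_n(C)`. -/
def borelOn (n : I → C) (ν : KeislerMeasure L C I) : Measure (typesExt (L := L) n) :=
  ν.borel.comap Subtype.val

theorem isProbabilityMeasure_borelOn {ν : KeislerMeasure L C I} (hν : ConcentratedOn n ν) :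
    IsProbabilityMeasure (borelOn n ν) := ⟨by
  rw [borelOn, (MeasurableEmbedding.subtype_coe (isClosed_typesExt n).measurableSet).comap_apply,
    Set.image_univ, Subtype.range_coe, borel_typesExt hν]⟩

/-- The star product `μ ∗ ν` of an `M`-definable Keisler measure `μ` and a Keisler measure `ν`
concentrated on `tp(n / ∅)`:
`(μ ∗ ν)(θ(x; b)) = ∫_{q ∈ S_n(C)} (F_μ^θ ∘ res_M ∘ h_b)(q) dν(q)`. -/
def star (hC : IsMonster L C κ) (hM : #M < κ) (hMn : M ⊆ Set.range n)
    (μ : KeislerMeasure L C I) (hμ : DefinableOver M μ)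
    (ν : KeislerMeasure L C I) (hν : ConcentratedOn n ν) : KeislerMeasure L C I where
  toFun φ := ∫ q, starVal hMn μ q φ ∂(borelOn n ν)
  nonneg' φ := integral_nonneg fun q => (starAt hC hM hMn μ hμ.1 q).nonneg φ
  total' φ h := by
    have := isProbabilityMeasure_borelOn hν
    have h1 : ∀ q, starVal hMn μ q φ = 1 := fun q => (starAt hC hM hMn μ hμ.1 q).total h
    simp [h1]
  additive' φ ψ h := by
    have := isProbabilityMeasure_borelOn hν
    have : CompactSpace (typesExt (L := L) n) :=
      isCompact_iff_compactSpace.1 (isClosed_typesExt n).isCompact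
    have h1 : ∀ q, starVal hMn μ q (φ ⊔ ψ) = starVal hMn μ q φ + starVal hMn μ q ψ :=
      fun q => (starAt hC hM hMn μ hμ.1 q).additive h
    have hint : ∀ φ, Integrable (fun q => starVal hMn μ q φ) (borelOn n ν) := fun φ =>
      (continuous_starVal hC hM hMn hμ φ).integrable_of_hasCompactSupport
        (HasCompactSupport.of_compactSpace _)
    simp only [h1]
    exact integral_add (hint φ) (hint ψ)

/-- The complete type of a `{0, 1}`-valued Keisler measure. -/
def KeislerMeasure.toType (m : KeislerMeasure L C I) (h : ∀ φ, m φ = 0 ∨ m φ = 1) :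
    GlobalType L C I where
  toTheory := {s | m (Formula.equivSentence.symm s) = 1}
  subset' := by
    rintro _ ⟨s, hs, rfl⟩
    refine m.total fun v => (Formula.realize_equivSentence_symm C _ v).2 ?_
    let _ : (constantsOn I).Structure C := constantsOn.structure v
    exact (LHom.realize_onSentence C (L[[C]].lhomWithConstants I) s).2 hs
  isMaximal' := by
    refine ⟨isSatisfiable_iff_isFinitelySatisfiable.2 fun T₀ hT₀ => ?_, fun s => ?_⟩
    · have key : ∀ T₁ : Finset L[[C]][[I]].Sentence,
          (∀ s ∈ T₁, m (Formula.equivSentence.symm s) = 1) → ∃ φ : L[[C]].Formula I, m φ = 1 ∧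
            ∀ v : I → C, φ.Realize v → ∀ s ∈ T₁, (Formula.equivSentence.symm s).Realize v := by
        classical
        intro T₁
        induction T₁ using Finset.induction_on with
        | empty => exact fun _ => ⟨⊤, m.total fun v => Formula.realize_top.2 trivial, by simp⟩
        | insert s T₁ _ ih =>
          intro hs
          obtain ⟨φ, h1, h2⟩ := ih fun t ht => hs t (Finset.mem_insert_of_mem ht)
          refine ⟨φ ⊓ Formula.equivSentence.symm s, ?_, fun v hv t ht => ?_⟩
          · have h3 := m.eq_add φ (Formula.equivSentence.symm s)
            have h4 := m.mono (φ := φ ⊓ (Formula.equivSentence.symm s).not)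
              (ψ := (Formula.equivSentence.symm s).not) fun v hv => (Formula.realize_inf.1 hv).2
            rw [m.not_eq, hs s (Finset.mem_insert_self _ _)] at h4
            linarith [m.nonneg (φ ⊓ (Formula.equivSentence.symm s).not)]
          · rw [Formula.realize_inf] at hv
            rcases Finset.mem_insert.1 ht with rfl | ht
            · exact hv.2
            · exact h2 v hv.1 t ht
      obtain ⟨φ, h1, h2⟩ := key T₀ hT₀
      obtain ⟨v, hv⟩ : ∃ v : I → C, φ.Realize v := by
        by_contra hne
        push Not at hne
        have := m.total (φ := φ.not) fun v => Formula.realize_not.2 (hne v)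
        rw [m.not_eq] at this
        linarith
      let _ : (constantsOn I).Structure C := constantsOn.structure v
      have : C ⊨ (T₀ : L[[C]][[I]].Theory) :=
        (model_iff _).2 fun s hs => (Formula.realize_equivSentence_symm C s v).1 (h2 v hv s hs)
      exact Model.isSatisfiable C
    · have h1 : m (Formula.equivSentence.symm s.not) =
          1 - m (Formula.equivSentence.symm s) := by
        rw [← m.not_eq]
        refine m.congr fun v => ?_
        rw [Formula.realize_not, Formula.realize_equivSentence_symm,
          Formula.realize_equivSentence_symm, Sentence.realize_not]
      rcases h (Formula.equivSentence.symm s) with h' | h'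
      · right
        change m (Formula.equivSentence.symm s.not) = 1
        rw [h1, h', sub_zero]
      · exact Or.inl h'

theorem KeislerMeasure.mem_toType (m : KeislerMeasure L C I) (h : ∀ φ, m φ = 0 ∨ m φ = 1)
    (φ : L[[C]].Formula I) : Formula.equivSentence φ ∈ m.toType h ↔ m φ = 1 := by
  change m (Formula.equivSentence.symm (Formula.equivSentence φ)) = 1 ↔ _
  rw [Equiv.symm_apply_apply]

theorem starAt_dirac_eq_zero_or_one (hC : IsMonster L C κ) (hM : #M < κ)
    (hMn : M ⊆ Set.range n) {p : GlobalType L C I} (hp : TypeInvariant M p)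
    (q : typesExt (L := L) n) (φ : L[[C]].Formula I) :
    starAt hC hM hMn (dirac p) (measureInvariant_dirac hp) q φ = 0 ∨
      starAt hC hM hMn (dirac p) (measureInvariant_dirac hp) q φ = 1 := by
  obtain ⟨k, θ, b, h⟩ := exists_inst φ
  obtain ⟨d, hd⟩ := hC.saturated M hM k (restr hMn (hMap n b q))
  change starVal hMn (dirac p) q φ = 0 ∨ starVal hMn (dirac p) q φ = 1
  rw [starVal_eq hC hM hMn (measureInvariant_dirac hp) q h hd]
  exact dirac_eq_zero_or_one _ _

/-- The star product `p ∗ q` of an `M`-invariant type `p` and a type `q` in `S_n(C)`: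
`θ(x; b) ∈ p ∗ q` if and only if `θ(x; y) ∈ p ⊗ h_b(q)`, that is, if and only if `θ(x; d) ∈ p` for
`d` realizing `h_b(q)` over `M` (see `mem_starType`). -/
def starType (hC : IsMonster L C κ) (hM : #M < κ) (hMn : M ⊆ Set.range n) (p : GlobalType L C I)
    (hp : TypeInvariant M p) (q : typesExt (L := L) n) : GlobalType L C I :=
  (starAt hC hM hMn (dirac p) (measureInvariant_dirac hp) q).toType
    (starAt_dirac_eq_zero_or_one hC hM hMn hp q)

theorem mem_starType (hC : IsMonster L C κ) (hM : #M < κ) (hMn : M ⊆ Set.range n)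
    {p : GlobalType L C I} (hp : TypeInvariant M p) (q : typesExt (L := L) n)
    {k : ℕ} (θ : L.Formula (I ⊕ Fin k)) (b : Fin k → C) {d : Fin k → C}
    (hd : tpOver L M d = restr hMn (hMap n b q)) :
    Formula.equivSentence (inst θ b) ∈ starType hC hM hMn p hp q ↔
      Formula.equivSentence (inst θ d) ∈ p := by
  rw [starType, KeislerMeasure.mem_toType, ← dirac_eq_one_iff]
  change starVal hMn (dirac p) q (inst θ b) = 1 ↔ _
  rw [starVal_eq hC hM hMn (measureInvariant_dirac hp) q (fun _ => Iff.rfl) hd]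

theorem exists_mem_hMap_iff (n : I → C) {k : ℕ} (s : L[[Set.range n]][[Fin k]].Sentence) :
    ∃ θ : L.Formula (I ⊕ Fin k), ∀ (q : typesExt (L := L) n) (b : Fin k → C),
      s ∈ hMap n b q ↔ Formula.equivSentence (inst θ b) ∈ q.1 := by
  refine ⟨Formula.relabel (Sum.map (pick n) id)
    (BoundedFormula.constantsVarsEquiv (Formula.equivSentence.symm s) :
      L.Formula (Set.range n ⊕ Fin k)), fun q b => ?_⟩
  obtain ⟨q, hq⟩ := q
  obtain ⟨X, a, rfl⟩ := exists_realization q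
  refine (hHom_mem_typeOf n b X a _).trans ?_
  let _ := (L.lhomWithConstants C).reduct X
  let _ : (constantsOn (Set.range n)).Structure X := constantsOn.structure (a ∘ pick n)
  rw [CompleteType.formula_mem_typeOf, realize_inst, Formula.realize_relabel, Sum.elim_comp_map]
  refine (Formula.realize_equivSentence_symm X s _).symm.trans ?_
  exact BoundedFormula.realize_constantsVarsEquiv.symm

theorem hMap_aut {q : typesExt (L := L) n} (hq : TypeInvariant M q.1) {σ : C ≃[L] C}
    (hσ : ∀ m ∈ M, σ m = m) {k : ℕ} (b : Fin k → C) : hMap n (σ ∘ b) q = hMap n b q := by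
  refine SetLike.ext fun s => ?_
  obtain ⟨θ, hθ⟩ := exists_mem_hMap_iff n s
  rw [hθ, hθ]
  exact hq σ hσ k θ b

theorem starType_mem_invTypes (hC : IsMonster L C κ) (hM : #M < κ) (hMn : M ⊆ Set.range n)
    {p : GlobalType L C I} (hp : p ∈ invTypes M n) {q : GlobalType L C I}
    (hq : q ∈ invTypes M n) :
    starType hC hM hMn p hp.2 ⟨q, hq.1⟩ ∈ invTypes M n := by
  refine ⟨fun θ hθ => ?_, fun σ hσ k θ b => ?_⟩
  · let θ' : L.Formula (I ⊕ Fin 0) := θ.relabel Sum.inl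
    have h : ∀ (b : Fin 0 → C) (v : I → C),
        ((L.lhomWithConstants C).onFormula θ).Realize v ↔ (inst θ' b).Realize v := by
      intro b v
      rw [realize_inst, Formula.realize_relabel, LHom.realize_onFormula]
      rfl
    obtain ⟨d, hd⟩ := hC.saturated M hM 0 (restr hMn (hMap n Fin.elim0 ⟨q, hq.1⟩))
    rw [starType, KeislerMeasure.mem_toType]
    change starVal hMn (dirac p) ⟨q, hq.1⟩ _ = 1
    rw [starVal_eq hC hM hMn (measureInvariant_dirac hp.2) _ (h Fin.elim0) hd,
      ← (dirac p).congr (h d), dirac_eq_one_iff]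
    exact hp.1 θ hθ
  · obtain ⟨d, hd⟩ := hC.saturated M hM k (restr hMn (hMap n b ⟨q, hq.1⟩))
    have hd' := hd
    rw [← hMap_aut (q := ⟨q, hq.1⟩) hq.2 hσ] at hd'
    rw [mem_starType hC hM hMn hp.2 _ θ b hd, mem_starType hC hM hMn hp.2 _ θ _ hd']

/-- The operation `∗` on `S_n^inv(C, M)`. -/
def invStar (hC : IsMonster L C κ) (hM : #M < κ) (hMn : M ⊆ Set.range n)
    (p q : invTypes (L := L) M n) : invTypes (L := L) M n :=
  ⟨starType hC hM hMn p.1 p.2.2 ⟨q.1, q.2.1⟩, starType_mem_invTypes hC hM hMn p.2 q.2⟩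

/-- `S_n^inv(C, M)` is a semigroup under `∗`. -/
theorem invStar_assoc (hC : IsMonster L C κ) (hM : #M < κ) (hMn : M ⊆ Set.range n)
    (p q r : invTypes (L := L) M n) :
    invStar hC hM hMn (invStar hC hM hMn p q) r = invStar hC hM hMn p (invStar hC hM hMn q r) := by
  refine Subtype.ext (SetLike.ext fun s => ?_)
  obtain ⟨φ, rfl⟩ := Formula.equivSentence.surjective s
  obtain ⟨k, θ, b, h⟩ := exists_inst φ
  have hφ : ∀ t : GlobalType L C I,
      Formula.equivSentence φ ∈ t ↔ Formula.equivSentence (inst θ b) ∈ t := fun t =>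
    ⟨fun ht => basicSet_subset_of_realize (fun v => (h v).1) ht,
      fun ht => basicSet_subset_of_realize (fun v => (h v).2) ht⟩
  rw [hφ, hφ]
  obtain ⟨d, hd⟩ := hC.saturated M hM k (restr hMn (hMap n b ⟨r.1, r.2.1⟩))
  obtain ⟨e, he⟩ := hC.saturated M hM k (restr hMn (hMap n d ⟨q.1, q.2.1⟩))
  have key : hMap n b ⟨(invStar hC hM hMn q r).1, (invStar hC hM hMn q r).2.1⟩ =
      hMap n d ⟨q.1, q.2.1⟩ := by
    refine SetLike.ext fun s => ?_
    obtain ⟨θ, hθ⟩ := exists_mem_hMap_iff n s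
    rw [hθ, hθ]
    exact mem_starType hC hM hMn q.2.2 _ θ b hd
  have he' := he
  rw [← key] at he'
  have h1 := mem_starType hC hM hMn (invStar hC hM hMn p q).2.2 ⟨r.1, r.2.1⟩ θ b hd
  have h2 := mem_starType hC hM hMn p.2.2 ⟨q.1, q.2.1⟩ θ d he
  have h3 := mem_starType hC hM hMn p.2.2
    ⟨(invStar hC hM hMn q r).1, (invStar hC hM hMn q r).2.1⟩ θ b he'
  exact (h1.trans h2).trans h3.symm

/-- `supp(μ) ∩ S_n^inv(C, M)` as a subset of the semigroup `S_n^inv(C, M)`. -/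
def suppInv (M : Set C) (n : I → C) (μ : KeislerMeasure L C I) : Set (invTypes (L := L) M n) :=
  {p | p.1 ∈ supp μ}

/-- `μ` is idempotent: `μ ∗ μ = μ`. -/
def IsIdempotent (hC : IsMonster L C κ) (hM : #M < κ) (hMn : M ⊆ Set.range n)
    (μ : KeislerMeasure L C I) (hμ : DefinableOver M μ) (hμn : ConcentratedOn n μ) : Prop :=
  star hC hM hMn μ hμ μ hμn = μ

/-- The right stabilizer `{q ∈ S_n(C) | μ ∗ q = μ}`, where `μ ∗ q` is the star product of `μ` and
the Dirac measure of `q`. -/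
def stabR (hC : IsMonster L C κ) (hM : #M < κ) (hMn : M ⊆ Set.range n)
    (μ : KeislerMeasure L C I) (hμ : DefinableOver M μ) : Set (GlobalType L C I) :=
  {q | ∃ hq : q ∈ typesExt n, star hC hM hMn μ hμ (dirac q) (concentratedOn_dirac hq) = μ}

end Star

/-! ### Left ideals -/

section Ideals

variable {X : Type*} (op : X → X → X)

/-- `S` is closed under `op`. -/
def IsSubsemigroup (S : Set X) : Prop := ∀ s ∈ S, ∀ t ∈ S, op s t ∈ S

/-- `J` is a left ideal of `S`: a nonempty subset with `S J ⊆ J`. -/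
def IsLeftIdeal (S J : Set X) : Prop :=
  J.Nonempty ∧ J ⊆ S ∧ ∀ s ∈ S, ∀ j ∈ J, op s j ∈ J

/-- `J` is a minimal left ideal of `S`. -/
def IsMinimalLeftIdeal (S J : Set X) : Prop :=
  IsLeftIdeal op S J ∧ ∀ J', IsLeftIdeal op S J' → J' ⊆ J → J' = J

/-- `S` is left-simple: it has no proper left ideals. -/
def IsLeftSimple (S : Set X) : Prop :=
  ∀ J, IsLeftIdeal op S J → J = S

end Ideals

end

end KeislerStar

namespace KeislerStar

/-! ### Left ideals in compact left-continuous semigroups -/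

section CompactSemigroup

variable {X : Type*} {op : X → X → X} {S : Set X}

/-! For a formula φ put f_φ(q) = (μ ∗ q)(φ), which is `starVal hMn μ q φ`. Definability of μ makes
f_φ continuous on the compact space S_n(C), and idempotence says that its μ-mean is μ(φ). For an
invariant type q, the preimage of [φ] under p ↦ p ∗ q is a clopen set [ψ] with f_φ(q) = μ(ψ) and
f_φ(p ∗ q) = f_ψ(p) (`exists_mem_invStar_iff`). So the μ-mean of p ↦ f_φ(p ∗ q) is f_φ(q): the
function f_φ is harmonic, and the proof rests on a maximum principle for it.

If f_φ attains its maximum over supp(μ) at q, then it is constant on supp(μ) ∗ q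
(`exists_starVal_max`), because a continuous function bounded on the support by its mean is constant
there (`eq_of_le_integral_borelOn`). The same fact, applied to -f_φ when μ(φ) = 0, shows that
supp(μ) is closed under ∗.

Two consequences give the equivalences. First, supp(μ) has no proper closed two-sided ideal J
(`eq_suppInv_of_isLeftIdeal`): if [φ] misses J, then f_φ vanishes on J, and J meets supp(μ) ∗ q,
where f_φ takes its maximum; hence f_φ = 0 on the support and μ(φ) = 0. A unique minimal left ideal
is two-sided, because its right translates are again minimal left ideals, and it is closed, being of
the form supp(μ) ∗ j. So it is all of supp(μ), and its minimality is left-simplicity.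

Second, if supp(μ) is left-simple, then supp(μ) ∗ q = supp(μ), so each f_φ is constant on the
support with value its mean μ(φ), which says that μ ∗ p = μ for p in the support. Conversely, μ ∗ q
= μ forces supp(μ) ⊆ supp(μ) ∗ q by compactness, so every left ideal containing q is everything. -/

theorem isLeftIdeal_image (hassoc : ∀ p q r, op (op p q) r = op p (op q r))
    (hS : IsSubsemigroup op S) {L : Set X} (hL : IsLeftIdeal op S L) {s : X} (hs : s ∈ S) :
    IsLeftIdeal op S ((op · s) '' L) := by
  refine ⟨hL.1.image _, ?_, ?_⟩
  · rintro _ ⟨l, hl, rfl⟩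
    exact hS l (hL.2.1 hl) s hs
  · rintro t ht _ ⟨l, hl, rfl⟩
    exact ⟨op t l, hL.2.2 t ht l hl, hassoc t l s⟩

theorem isLeftIdeal_self (hS : IsSubsemigroup op S) (hne : S.Nonempty) : IsLeftIdeal op S S :=
  ⟨hne, subset_rfl, hS⟩

theorem IsLeftIdeal.image_subset {J : Set X} (hJ : IsLeftIdeal op S J) {s : X} (hs : s ∈ J) :
    (op · s) '' S ⊆ J := by
  rintro _ ⟨t, ht, rfl⟩
  exact hJ.2.2 t ht s hs

/-- A minimal left ideal `J` is generated by each of its elements. -/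
theorem IsMinimalLeftIdeal.image_eq (hassoc : ∀ p q r, op (op p q) r = op p (op q r))
    (hS : IsSubsemigroup op S) {J : Set X} (hJ : IsMinimalLeftIdeal op S J) {s : X} (hs : s ∈ J) :
    (op · s) '' S = J :=
  hJ.2 _ (isLeftIdeal_image hassoc hS (isLeftIdeal_self hS (hJ.1.1.mono hJ.1.2.1)) (hJ.1.2.1 hs))
    (hJ.1.image_subset hs)

/-- The right translates of a minimal left ideal are minimal left ideals. -/
theorem IsMinimalLeftIdeal.image (hassoc : ∀ p q r, op (op p q) r = op p (op q r))
    (hS : IsSubsemigroup op S) {J : Set X} (hJ : IsMinimalLeftIdeal op S J) {s : X} (hs : s ∈ S) :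
    IsMinimalLeftIdeal op S ((op · s) '' J) := by
  refine ⟨isLeftIdeal_image hassoc hS hJ.1 hs, fun J' hJ' hsub => hsub.antisymm ?_⟩
  -- A left ideal inside the translate of J pulls back to a left ideal inside J, which is J by
  -- minimality.
  have h : {l | l ∈ J ∧ op l s ∈ J'} = J := by
    refine hJ.2 _ ⟨?_, fun l hl => hJ.1.2.1 hl.1, fun t ht l hl => ⟨hJ.1.2.2 t ht l hl.1, ?_⟩⟩
      fun l hl => hl.1
    · obtain ⟨j, hj⟩ := hJ'.1
      obtain ⟨l, hl, rfl⟩ := hsub hj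
      exact ⟨l, hl, hj⟩
    · rw [hassoc]
      exact hJ'.2.2 t ht _ hl.2
  rintro _ ⟨l, hl, rfl⟩
  rw [← h] at hl
  exact hl.2

/-- The translate of J by s is again a minimal left ideal, so uniqueness identifies it with J. Thus
J is also a right ideal of S. -/
theorem op_mem_of_unique_isMinimalLeftIdeal (hassoc : ∀ p q r, op (op p q) r = op p (op q r))
    (hS : IsSubsemigroup op S) {J : Set X} (hJ : IsMinimalLeftIdeal op S J)
    (huniq : ∀ J', IsMinimalLeftIdeal op S J' → J' = J) {j s : X} (hj : j ∈ J) (hs : s ∈ S) :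
    op j s ∈ J := by
  rw [← huniq _ (hJ.image hassoc hS hs)]
  exact ⟨j, hj, rfl⟩

/-- A left-simple semigroup is its own unique minimal left ideal. -/
theorem IsLeftSimple.existsUnique_isMinimalLeftIdeal (hS : IsSubsemigroup op S)
    (hne : S.Nonempty) (h : IsLeftSimple op S) : ∃! J, IsMinimalLeftIdeal op S J :=
  ⟨S, ⟨isLeftIdeal_self hS hne, fun J hJ _ => h J hJ⟩, fun J hJ => h J hJ.1⟩

end CompactSemigroup

/-! ### Supports -/

section Support

variable {L : FirstOrder.Language.{u, v}} {C : Type w} [L.Structure C] [Nonempty C] {I : Type x}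
  {μ : KeislerMeasure L C I}

theorem isClosed_supp (μ : KeislerMeasure L C I) : IsClosed (supp μ) := by
  rw [← isOpen_compl_iff, isOpen_iff_mem_nhds]
  intro p hp
  simp only [supp, Set.mem_compl_iff, Set.mem_ofPred_eq, not_forall] at hp
  obtain ⟨φ, hφ, h⟩ := hp
  exact Filter.mem_of_superset ((isClopen_basicSet φ).2.mem_nhds hφ) fun q hq hq' => h (hq' φ hq)

/-- The complement is a union of null basic sets, possibly uncountable. Regularity reduces the claim
to compact subsets, for which being locally null is enough. -/
theorem borel_compl_supp (μ : KeislerMeasure L C I) : μ.borel (supp μ)ᶜ = 0 := by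
  rw [(isClosed_supp μ).isOpen_compl.measure_eq_iSup_isCompact]
  simp only [ENNReal.iSup_eq_zero]
  intro K hK hKc
  refine hKc.measure_zero_of_nhdsWithin fun p hp => ?_
  have : ¬ p ∈ supp μ := hK hp
  simp only [supp, Set.mem_ofPred_eq, not_forall] at this
  obtain ⟨φ, hφ, h⟩ := this
  refine ⟨basicSet φ, mem_nhdsWithin_of_mem_nhds ((isClopen_basicSet φ).2.mem_nhds hφ), ?_⟩
  rw [μ.borel_basicSet, ENNReal.ofReal_eq_zero]
  exact not_lt.1 h

theorem exists_mem_supp_of_pos {φ : L[[C]].Formula I} (h : 0 < μ φ) :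
    ∃ p ∈ supp μ, p ∈ basicSet φ := by
  by_contra! hne
  have h1 : μ.borel (basicSet φ) = 0 :=
    measure_mono_null (fun p hp hp' => hne p hp' hp) (borel_compl_supp μ)
  rw [μ.borel_basicSet, ENNReal.ofReal_eq_zero] at h1
  exact h1.not_gt h

theorem supp_nonempty (μ : KeislerMeasure L C I) : (supp μ).Nonempty := by
  obtain ⟨p, hp, -⟩ := exists_mem_supp_of_pos (μ := μ) (φ := ⊤) (by
    rw [μ.total fun v => Formula.realize_top.2 trivial]
    exact one_pos)
  exact ⟨p, hp⟩

variable {n : I → C}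

theorem borelOn_apply (n : I → C) (μ : KeislerMeasure L C I) (U : Set (typesExt (L := L) n)) :
    borelOn n μ U = μ.borel (Subtype.val '' U) :=
  (MeasurableEmbedding.subtype_coe (isClosed_typesExt n).measurableSet).comap_apply _ _

theorem ae_borelOn_mem_supp (n : I → C) (μ : KeislerMeasure L C I) :
    ∀ᵐ q ∂borelOn n μ, q.1 ∈ supp μ := by
  rw [ae_iff, borelOn_apply]
  refine measure_mono_null ?_ (borel_compl_supp μ)
  rintro _ ⟨q, hq, rfl⟩
  exact hq

/-- An open neighbourhood of a support point contains a basic set of positive measure, and cutting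
down to S_n(C) loses nothing because its complement is null. -/
theorem borelOn_pos (hμn : ConcentratedOn n μ) {U : Set (typesExt (L := L) n)} (hU : IsOpen U)
    {p : typesExt (L := L) n} (hp : p.1 ∈ supp μ) (hpU : p ∈ U) : 0 < borelOn n μ U := by
  obtain ⟨V, hV, rfl⟩ := isOpen_induced_iff.1 hU
  obtain ⟨φ, h1, h2⟩ := exists_basicSet_subset hV hpU
  have h3 : μ.borel (typesExt n)ᶜ = 0 :=
    (prob_compl_eq_zero_iff (isClosed_typesExt n).measurableSet).2 (borel_typesExt hμn)
  rw [borelOn_apply, Subtype.image_preimage_coe, Set.inter_comm,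
    measure_inter_conull h3]
  refine lt_of_lt_of_le ?_ (measure_mono h2)
  rw [μ.borel_basicSet]
  exact ENNReal.ofReal_pos.2 (hp φ h1)

theorem integrable_borelOn (hμn : ConcentratedOn n μ) {g : typesExt (L := L) n → ℝ}
    (hg : Continuous g) : Integrable g (borelOn n μ) := by
  have := isProbabilityMeasure_borelOn hμn
  have : CompactSpace (typesExt (L := L) n) :=
    isCompact_iff_compactSpace.1 (isClosed_typesExt n).isCompact
  exact hg.integrable_of_hasCompactSupport (HasCompactSupport.of_compactSpace _)

theorem integral_borelOn_eq_const (hμn : ConcentratedOn n μ) {g : typesExt (L := L) n → ℝ} {c : ℝ}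
    (h : ∀ q, q.1 ∈ supp μ → g q = c) : ∫ q, g q ∂borelOn n μ = c := by
  have := isProbabilityMeasure_borelOn hμn
  rw [integral_congr_ae ((ae_borelOn_mem_supp n μ).mono h)]
  simp

/-- A continuous function that is bounded by its mean on the support is constant there. -/
theorem eq_of_le_integral_borelOn (hμn : ConcentratedOn n μ) {g : typesExt (L := L) n → ℝ}
    (hg : Continuous g) {c : ℝ} (hle : ∀ q, q.1 ∈ supp μ → g q ≤ c)
    (hc : ∫ q, g q ∂borelOn n μ = c) {q : typesExt (L := L) n} (hq : q.1 ∈ supp μ) : g q = c := by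
  have := isProbabilityMeasure_borelOn hμn
  have h0 : ∫ q, (c - g q) ∂borelOn n μ = 0 := by
    rw [integral_sub (integrable_const c) (integrable_borelOn hμn hg), hc]
    simp
  have hae := (integral_eq_zero_iff_of_nonneg_ae
    ((ae_borelOn_mem_supp n μ).mono fun q hq => sub_nonneg.2 (hle q hq))
    ((integrable_const c).sub (integrable_borelOn hμn hg))).1 h0
  by_contra hne
  -- The set where g differs from c is open and contains a point of the support, so it has positive
  -- measure; but c - g is nonnegative almost everywhere with integral zero, so this set is null.
  have hpos := borelOn_pos hμn (U := {q | c - g q ≠ 0})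
    (isOpen_ne_fun (continuous_const.sub hg) continuous_const) hq (sub_ne_zero.2 (Ne.symm hne))
  exact hpos.ne' hae

end Support

/-! ### The semigroup of invariant types -/

section Star

variable {L : FirstOrder.Language.{u, v}} {C : Type w} [L.Structure C] [Nonempty C] {I : Type x}
  {κ : Cardinal.{w}} {M : Set C} {n : I → C}

theorem mem_basicSet_congr {φ ψ : L[[C]].Formula I} (h : ∀ v : I → C, φ.Realize v ↔ ψ.Realize v)
    (p : GlobalType L C I) : p ∈ basicSet φ ↔ p ∈ basicSet ψ :=
  ⟨fun hp => basicSet_subset_of_realize (fun v => (h v).1) hp,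
    fun hp => basicSet_subset_of_realize (fun v => (h v).2) hp⟩

/-- The preimage of `[φ]` under `p ↦ p ∗ q` is a clopen set `[ψ]`, with `μ(ψ) = (μ ∗ q)(φ)`. -/
theorem exists_mem_invStar_iff (hC : IsMonster L C κ) (hM : #M < κ) (hMn : M ⊆ Set.range n)
    (q : invTypes (L := L) M n) (φ : L[[C]].Formula I) : ∃ ψ : L[[C]].Formula I,
      (∀ p, (invStar hC hM hMn p q).1 ∈ basicSet φ ↔ p.1 ∈ basicSet ψ) ∧
      (∀ μ : KeislerMeasure L C I, MeasureInvariant M μ →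
        starVal hMn μ ⟨q.1, q.2.1⟩ φ = μ ψ ∧
        ∀ p, starVal hMn μ ⟨(invStar hC hM hMn p q).1, (invStar hC hM hMn p q).2.1⟩ φ =
          starVal hMn μ ⟨p.1, p.2.1⟩ ψ) := by
  obtain ⟨k, θ, b, h⟩ := exists_inst φ
  obtain ⟨d, hd⟩ := hC.saturated M hM k (restr hMn (hMap n b ⟨q.1, q.2.1⟩))
  -- With φ written as θ(x; b), the formula ψ is θ(x; d) for d realizing h_b(q) over M; it depends
  -- on neither p nor μ.
  refine ⟨inst θ d, fun p => ?_, fun μ hμ =>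
    ⟨starVal_eq hC hM hMn hμ _ h hd, fun p => ?_⟩⟩
  · rw [mem_basicSet_congr h]
    exact mem_starType hC hM hMn p.2.2 ⟨q.1, q.2.1⟩ θ b hd
  · rw [starVal_inst hC hM hMn hμ _ h, starVal_inst hC hM hMn hμ _ fun _ => Iff.rfl]
    -- Both values come from the same fiber function, and h_b(p ∗ q) = h_d(p) already over all of N.
    congr 2
    refine SetLike.ext fun s => ?_
    obtain ⟨θ, hθ⟩ := exists_mem_hMap_iff n s
    rw [hθ, hθ]
    exact mem_starType hC hM hMn p.2.2 ⟨q.1, q.2.1⟩ θ b hd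

theorem continuous_invStar (hC : IsMonster L C κ) (hM : #M < κ) (hMn : M ⊆ Set.range n)
    (q : invTypes (L := L) M n) : Continuous fun p => invStar hC hM hMn p q := by
  refine continuous_induced_rng.2 (continuous_generateFrom_iff.2 ?_)
  rintro _ ⟨s, rfl⟩
  obtain ⟨φ, rfl⟩ := Formula.equivSentence.surjective s
  obtain ⟨ψ, hψ, -⟩ := exists_mem_invStar_iff hC hM hMn q φ
  convert (isClopen_basicSet ψ).2.preimage (continuous_subtype_val (p := (· ∈ invTypes M n)))
    using 1
  ext p
  exact hψ p

variable {μ : KeislerMeasure L C I}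

/-- The support is closed in the compact space of all global types and lies inside the invariant
types, so closedness of the set of invariant types is not needed. -/
theorem isCompact_suppInv (hsupp : supp μ ⊆ invTypes M n) : IsCompact (suppInv M n μ) := by
  rw [Subtype.isCompact_iff]
  convert (isClosed_supp μ).isCompact
  ext p
  exact ⟨fun ⟨q, hq, h⟩ => h ▸ hq, fun hp => ⟨⟨p, hsupp hp⟩, hp, rfl⟩⟩

theorem suppInv_nonempty (hsupp : supp μ ⊆ invTypes M n) : (suppInv M n μ).Nonempty := by
  obtain ⟨p, hp⟩ := supp_nonempty μ
  exact ⟨⟨p, hsupp hp⟩, hp⟩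

theorem isCompact_image_invStar (hC : IsMonster L C κ) (hM : #M < κ) (hMn : M ⊆ Set.range n)
    (hsupp : supp μ ⊆ invTypes M n) (q : invTypes (L := L) M n) :
    IsCompact ((invStar hC hM hMn · q) '' suppInv M n μ) :=
  (isCompact_suppInv hsupp).image (continuous_invStar hC hM hMn q)

/-! ### Idempotence as a mean value property, and the maximum principle -/

theorem integral_starVal (hC : IsMonster L C κ) (hM : #M < κ) (hMn : M ⊆ Set.range n)
    (hμ : DefinableOver M μ) (hμn : ConcentratedOn n μ)
    (hidem : IsIdempotent hC hM hMn μ hμ hμn) (φ : L[[C]].Formula I) :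
    ∫ q, starVal hMn μ q φ ∂borelOn n μ = μ φ :=
  DFunLike.congr_fun hidem φ

/-- If φ ∈ p ∗ q had measure zero, the nonnegative continuous function f_φ would have mean zero,
hence vanish at q ∈ supp(μ). But f_φ(q) = μ(ψ), where ψ ∈ p ∈ supp(μ) has positive measure. -/
theorem isSubsemigroup_suppInv (hC : IsMonster L C κ) (hM : #M < κ) (hMn : M ⊆ Set.range n)
    (hμ : DefinableOver M μ) (hμn : ConcentratedOn n μ)
    (hidem : IsIdempotent hC hM hMn μ hμ hμn) :
    IsSubsemigroup (invStar hC hM hMn) (suppInv (L := L) M n μ) := by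
  intro p hp q hq φ hφ
  obtain ⟨ψ, h1, h2⟩ := exists_mem_invStar_iff hC hM hMn q φ
  by_contra h0
  replace h0 : μ φ = 0 := le_antisymm (not_lt.1 h0) (μ.nonneg φ)
  have h3 := eq_of_le_integral_borelOn hμn (g := fun q => -starVal hMn μ q φ) (c := 0)
    (continuous_starVal hC hM hMn hμ φ).neg
    (fun q _ => neg_nonpos.2 ((starAt hC hM hMn μ hμ.1 q).nonneg φ))
    (by rw [integral_neg, integral_starVal hC hM hMn hμ hμn hidem, h0, neg_zero])
    (q := ⟨q.1, q.2.1⟩) hq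
  rw [(h2 μ hμ.1).1, neg_eq_zero] at h3
  exact (hp ψ ((h1 p).1 hφ)).ne' h3

/-- The function `q ↦ (μ ∗ q)(φ)` has a maximum on `supp(μ)` at some `q`, and it is constant on
`supp(μ) ∗ q`. -/
theorem exists_starVal_max (hC : IsMonster L C κ) (hM : #M < κ) (hMn : M ⊆ Set.range n)
    (hμ : DefinableOver M μ) (hμn : ConcentratedOn n μ)
    (hidem : IsIdempotent hC hM hMn μ hμ hμn) (hsupp : supp μ ⊆ invTypes M n)
    (φ : L[[C]].Formula I) : ∃ q ∈ suppInv (L := L) M n μ, ∃ c : ℝ,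
      (∀ p ∈ suppInv M n μ, starVal hMn μ ⟨p.1, p.2.1⟩ φ ≤ c) ∧
      ∀ p ∈ suppInv M n μ, starVal hMn μ ⟨(invStar hC hM hMn p q).1,
        (invStar hC hM hMn p q).2.1⟩ φ = c := by
  have hcont : Continuous fun q : invTypes (L := L) M n => starVal hMn μ ⟨q.1, q.2.1⟩ φ :=
    (continuous_starVal hC hM hMn hμ φ).comp (continuous_subtype_val.subtype_mk _)
  obtain ⟨q, hq, hmax⟩ :=
    (isCompact_suppInv hsupp).exists_isMaxOn (suppInv_nonempty hsupp) hcont.continuousOn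
  refine ⟨q, hq, _, hmax, fun p hp => ?_⟩
  obtain ⟨ψ, h1, h2⟩ := exists_mem_invStar_iff hC hM hMn q φ
  obtain ⟨h3, h4⟩ := h2 μ hμ.1
  rw [h4]
  -- On the support f_ψ(r) = f_φ(r ∗ q) is at most the maximum f_φ(q), as r ∗ q is again in the
  -- support; by idempotence the mean of f_ψ is μ(ψ) = f_φ(q). So the bound is attained throughout
  -- the support.
  refine eq_of_le_integral_borelOn hμn (g := fun p => starVal hMn μ p ψ)
    (continuous_starVal hC hM hMn hμ ψ) (fun r hr => ?_) ?_ (q := ⟨p.1, p.2.1⟩) hp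
  · have := h4 ⟨r.1, hsupp hr⟩
    rw [← this]
    exact hmax (isSubsemigroup_suppInv hC hM hMn hμ hμn hidem ⟨r.1, hsupp hr⟩ hr q hq)
  · exact (integral_starVal hC hM hMn hμ hμn hidem ψ).trans h3.symm

/-- The support of an idempotent measure has no proper closed two-sided ideal. -/
theorem eq_suppInv_of_isLeftIdeal (hC : IsMonster L C κ) (hM : #M < κ) (hMn : M ⊆ Set.range n)
    (hμ : DefinableOver M μ) (hμn : ConcentratedOn n μ)
    (hidem : IsIdempotent hC hM hMn μ hμ hμn) (hsupp : supp μ ⊆ invTypes M n)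
    {J : Set (invTypes (L := L) M n)} (hJ : IsLeftIdeal (invStar hC hM hMn) (suppInv M n μ) J)
    (hright : ∀ j ∈ J, ∀ s ∈ suppInv M n μ, invStar hC hM hMn j s ∈ J) (hclosed : IsCompact J) :
    J = suppInv M n μ := by
  refine hJ.2.1.antisymm fun r hr => ?_
  by_contra hrJ
  obtain ⟨φ, hrφ, hφ⟩ := exists_basicSet_subset (p := r.1) (U := (Subtype.val '' J)ᶜ)
    (hclosed.image continuous_subtype_val).isClosed.isOpen_compl (by
      rintro ⟨j, hj, h⟩
      exact hrJ (Subtype.ext h ▸ hj))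
  obtain ⟨q, hq, c, hle, hc⟩ := exists_starVal_max hC hM hMn hμ hμn hidem hsupp φ
  -- Otherwise μ(ψ) = f_φ(j) > 0 gives p in the support with ψ ∈ p, so that p ∗ j lies in [φ]; but p
  -- ∗ j ∈ J, and [φ] misses J.
  have hzero : ∀ j ∈ J, starVal hMn μ ⟨j.1, j.2.1⟩ φ = 0 := by
    intro j hj
    obtain ⟨ψ, h1, h2⟩ := exists_mem_invStar_iff hC hM hMn j φ
    rw [(h2 μ hμ.1).1]
    by_contra hne
    obtain ⟨p, hp, hpψ⟩ := exists_mem_supp_of_pos (lt_of_le_of_ne (μ.nonneg ψ) (Ne.symm hne))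
    exact hφ ((h1 ⟨p, hsupp hp⟩).2 hpψ) ⟨_, hJ.2.2 ⟨p, hsupp hp⟩ hp j hj, rfl⟩
  obtain ⟨j, hj⟩ := hJ.1
  -- The type j ∗ q lies in supp(μ) ∗ q, where f_φ = c, and in J, where f_φ = 0. Only here is it
  -- used that J is a right ideal.
  have hc0 : c = 0 := (hc j (hJ.2.1 hj)).symm.trans (hzero _ (hright j hj q hq))
  have h0 : μ φ = 0 := by
    rw [← integral_starVal hC hM hMn hμ hμn hidem]
    exact integral_borelOn_eq_const hμn fun p hp => le_antisymm
      ((hle ⟨p.1, hsupp hp⟩ hp).trans hc0.le) ((starAt hC hM hMn μ hμ.1 p).nonneg φ)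
  exact (hr φ hrφ).ne' h0

/-- Uniqueness makes J two-sided, and J is compact because a minimal left ideal equals supp(μ) ∗ j
for any j in it, a continuous image of the support. -/
theorem eq_suppInv_of_unique_isMinimalLeftIdeal (hC : IsMonster L C κ) (hM : #M < κ)
    (hMn : M ⊆ Set.range n) (hμ : DefinableOver M μ) (hμn : ConcentratedOn n μ)
    (hidem : IsIdempotent hC hM hMn μ hμ hμn) (hsupp : supp μ ⊆ invTypes M n)
    {J : Set (invTypes (L := L) M n)}
    (hJ : IsMinimalLeftIdeal (invStar hC hM hMn) (suppInv M n μ) J)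
    (huniq : ∀ J', IsMinimalLeftIdeal (invStar hC hM hMn) (suppInv M n μ) J' → J' = J) :
    J = suppInv M n μ := by
  have hS := isSubsemigroup_suppInv hC hM hMn hμ hμn hidem
  have hassoc := invStar_assoc (L := L) hC hM hMn
  refine eq_suppInv_of_isLeftIdeal hC hM hMn hμ hμn hidem hsupp hJ.1
    (fun j hj s hs => op_mem_of_unique_isMinimalLeftIdeal hassoc hS hJ huniq hj hs) ?_
  obtain ⟨j, hj⟩ := hJ.1.1
  rw [← hJ.image_eq hassoc hS hj]
  exact isCompact_image_invStar hC hM hMn hsupp j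

/-! ### Left-simplicity and the right stabilizer -/

/-- The maximum principle makes f_φ constant on supp(μ) ∗ q for some q in the support. This left
ideal is the whole support, so the constant is the mean μ(φ). -/
theorem starVal_eq_of_isLeftSimple (hC : IsMonster L C κ) (hM : #M < κ)
    (hMn : M ⊆ Set.range n) (hμ : DefinableOver M μ) (hμn : ConcentratedOn n μ)
    (hidem : IsIdempotent hC hM hMn μ hμ hμn) (hsupp : supp μ ⊆ invTypes M n)
    (hsimple : IsLeftSimple (invStar hC hM hMn) (suppInv (L := L) M n μ))
    {p : typesExt (L := L) n} (hp : p.1 ∈ supp μ) (φ : L[[C]].Formula I) :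
    starVal hMn μ p φ = μ φ := by
  have hS := isSubsemigroup_suppInv hC hM hMn hμ hμn hidem
  obtain ⟨q, hq, c, -, hc⟩ := exists_starVal_max hC hM hMn hμ hμn hidem hsupp φ
  have himage := hsimple _ (isLeftIdeal_image (invStar_assoc hC hM hMn) hS
    (isLeftIdeal_self hS (suppInv_nonempty hsupp)) hq)
  have hconst : ∀ r : typesExt (L := L) n, r.1 ∈ supp μ → starVal hMn μ r φ = c := by
    intro r hr
    have : (⟨r.1, hsupp hr⟩ : invTypes M n) ∈ suppInv M n μ := hr
    rw [← himage] at this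
    obtain ⟨s, hs, h⟩ := this
    have := hc s hs
    simp only [h] at this
    exact this
  rw [hconst p hp, ← integral_starVal hC hM hMn hμ hμn hidem,
    integral_borelOn_eq_const hμn hconst]

/-- The Borel measure of `dirac` is built from a content, not given as a point mass. Its support is
{q}, so any g is almost everywhere equal to g(q); no measurability of g is needed. -/
theorem integral_borelOn_dirac (q : typesExt (L := L) n) (g : typesExt (L := L) n → ℝ) :
    ∫ r, g r ∂borelOn n (dirac q.1) = g q := by
  have hsupp : ∀ r : typesExt (L := L) n, r.1 ∈ supp (dirac q.1) → g r = g q := by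
    intro r hr
    have : r = q := by
      refine Subtype.ext (SetLike.ext fun s => ?_)
      obtain ⟨φ, rfl⟩ := Formula.equivSentence.surjective s
      have key : ∀ φ : L[[C]].Formula I, r.1 ∈ basicSet φ → q.1 ∈ basicSet φ := by
        intro φ h
        have h1 := hr φ h
        rcases dirac_eq_zero_or_one q.1 φ with h2 | h2
        · exact absurd h2 h1.ne'
        · exact (dirac_eq_one_iff _ _).1 h2
      refine ⟨key φ, fun h => ?_⟩
      by_contra h'
      have h1 : r.1 ∈ basicSet φ.not := by
        rw [basicSet_not]
        exact h'
      have h2 := key _ h1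
      rw [basicSet_not] at h2
      exact h2 h
    rw [this]
  exact integral_borelOn_eq_const (concentratedOn_dirac q.2) hsupp

theorem mem_stabR_iff (hC : IsMonster L C κ) (hM : #M < κ) (hMn : M ⊆ Set.range n)
    (hμ : DefinableOver M μ) (q : typesExt (L := L) n) :
    q.1 ∈ stabR hC hM hMn μ hμ ↔ ∀ φ, starVal hMn μ q φ = μ φ := by
  have key : ∀ φ, star hC hM hMn μ hμ (dirac q.1) (concentratedOn_dirac q.2) φ =
      starVal hMn μ q φ := fun φ =>
    integral_borelOn_dirac q fun r => starVal hMn μ r φ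
  constructor
  · rintro ⟨hq, h⟩ φ
    rw [← key, h]
  · intro h
    exact ⟨q.2, DFunLike.ext _ _ fun φ => (key φ).trans (h φ)⟩

/-- If `μ ∗ q = μ`, then `supp(μ) ∗ q` contains `supp(μ)`. -/
theorem suppInv_subset_image_invStar (hC : IsMonster L C κ) (hM : #M < κ)
    (hMn : M ⊆ Set.range n) (hμ : MeasureInvariant M μ) (hsupp : supp μ ⊆ invTypes M n)
    {q : invTypes (L := L) M n} (hq : ∀ φ, starVal hMn μ ⟨q.1, q.2.1⟩ φ = μ φ) :
    suppInv M n μ ⊆ (invStar hC hM hMn · q) '' suppInv M n μ := by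
  intro r hr
  by_contra hne
  obtain ⟨φ, hrφ, hφ⟩ := exists_basicSet_subset (p := r.1)
    (U := (Subtype.val '' ((invStar hC hM hMn · q) '' suppInv M n μ))ᶜ)
    ((isCompact_image_invStar hC hM hMn hsupp q).image
      continuous_subtype_val).isClosed.isOpen_compl (by
      rintro ⟨j, hj, h⟩
      exact hne (Subtype.ext h ▸ hj))
  obtain ⟨ψ, h1, h2⟩ := exists_mem_invStar_iff hC hM hMn q φ
  have hpos := hr φ hrφ
  rw [← hq, (h2 μ hμ).1] at hpos
  obtain ⟨p, hp, hpψ⟩ := exists_mem_supp_of_pos hpos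
  exact hφ ((h1 ⟨p, hsupp hp⟩).2 hpψ) ⟨_, ⟨⟨p, hsupp hp⟩, hp, rfl⟩, rfl⟩

/-- For a left ideal J and j ∈ J stabilizing μ, the chain supp(μ) ⊆ supp(μ) ∗ j ⊆ J gives
left-simplicity. The converse is the constancy of each f_φ on the support. -/
theorem supp_subset_stabR_iff (hC : IsMonster L C κ) (hM : #M < κ)
    (hMn : M ⊆ Set.range n) (hμ : DefinableOver M μ) (hμn : ConcentratedOn n μ)
    (hidem : IsIdempotent hC hM hMn μ hμ hμn) (hsupp : supp μ ⊆ invTypes M n) :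
    supp μ ⊆ stabR hC hM hMn μ hμ ↔
      IsLeftSimple (invStar hC hM hMn) (suppInv (L := L) M n μ) := by
  constructor
  · intro h J hJ
    obtain ⟨j, hj⟩ := hJ.1
    refine hJ.2.1.antisymm (Set.Subset.trans ?_ (hJ.image_subset hj))
    exact suppInv_subset_image_invStar hC hM hMn hμ.1 hsupp
      ((mem_stabR_iff hC hM hMn hμ ⟨j.1, j.2.1⟩).1 (h (hJ.2.1 hj)))
  · intro h p hp
    exact (mem_stabR_iff hC hM hMn hμ ⟨p, (hsupp hp).1⟩).2
      (starVal_eq_of_isLeftSimple hC hM hMn hμ hμn hidem hsupp h hp)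

end Star

end KeislerStar

theorem mainTheorem5 {L : FirstOrder.Language.{u, v}} {C : Type w} [L.Structure C] [Nonempty C]
    (κ : Cardinal.{w}) (hC : KeislerStar.IsMonster L C κ)
    (M N : L.ElementarySubstructure C) (hM : #(M : Set C) < κ)
    {I : Type x} (n : I → C) (hn : Set.range n = (N : Set C)) (hMn : (M : Set C) ⊆ Set.range n)
    (μ : KeislerStar.KeislerMeasure L C I)
    (hμn : KeislerStar.ConcentratedOn n μ)
    (hμ : KeislerStar.DefinableOver (M : Set C) μ)
    (hidem : KeislerStar.IsIdempotent hC hM hMn μ hμ hμn)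
    (hsupp : KeislerStar.supp μ ⊆ KeislerStar.invTypes (M : Set C) n) :
    KeislerStar.IsSubsemigroup (KeislerStar.invStar hC hM hMn)
        (KeislerStar.suppInv (M : Set C) n μ) ∧
    (KeislerStar.supp μ ⊆ KeislerStar.stabR hC hM hMn μ hμ ↔
      KeislerStar.IsLeftSimple (KeislerStar.invStar hC hM hMn)
        (KeislerStar.suppInv (M : Set C) n μ)) ∧
    (KeislerStar.IsLeftSimple (KeislerStar.invStar hC hM hMn)
        (KeislerStar.suppInv (M : Set C) n μ) ↔
      ∃! J, KeislerStar.IsMinimalLeftIdeal (KeislerStar.invStar hC hM hMn)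
        (KeislerStar.suppInv (M : Set C) n μ) J) ∧
    (∀ J, KeislerStar.IsMinimalLeftIdeal (KeislerStar.invStar hC hM hMn)
        (KeislerStar.suppInv (M : Set C) n μ) J →
      (∀ J', KeislerStar.IsMinimalLeftIdeal (KeislerStar.invStar hC hM hMn)
        (KeislerStar.suppInv (M : Set C) n μ) J' → J' = J) →
      J = KeislerStar.suppInv (M : Set C) n μ) := by
  have hS := KeislerStar.isSubsemigroup_suppInv hC hM hMn hμ hμn hidem
  have hunique : ∀ J, KeislerStar.IsMinimalLeftIdeal (KeislerStar.invStar hC hM hMn)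
        (KeislerStar.suppInv (M : Set C) n μ) J →
      (∀ J', KeislerStar.IsMinimalLeftIdeal (KeislerStar.invStar hC hM hMn)
        (KeislerStar.suppInv (M : Set C) n μ) J' → J' = J) →
      J = KeislerStar.suppInv (M : Set C) n μ := fun J hJ huniq =>
    KeislerStar.eq_suppInv_of_unique_isMinimalLeftIdeal hC hM hMn hμ hμn hidem hsupp hJ huniq
  refine ⟨hS, KeislerStar.supp_subset_stabR_iff hC hM hMn hμ hμn hidem hsupp, ⟨fun h =>
    h.existsUnique_isMinimalLeftIdeal hS (KeislerStar.suppInv_nonempty hsupp), ?_⟩, hunique⟩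
  rintro ⟨J, hJ, huniq⟩
  -- Once J is the whole support, every left ideal lies inside J, so minimality of J is
  -- left-simplicity.
  obtain rfl := hunique J hJ huniq
  exact fun J' hJ' => hJ.2 J' hJ' hJ'.2.1
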